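/- Setting. Let $\mathcal P=\{x\in\mathbb R^p: Cx\le d\}$ ($C\in\mathbb R^{q\times p}$, $d\in\mathbb R^q$) be non-empty and compact, with vertex set $V$ and diameter $D$. Let $f_1,\dots,f_n:\mathbb R^p\to\mathbb R$ ($n\ge1$) be differentiable, $f_i$ strongly convex with parameter $\sigma_i>0$ and with $L_i$-Lipschitz gradient. Put $F=\frac1n\sum_i f_i$, $F^*=\min_{\mathcal P}F$, $\sigma_F=\min_i\sigma_i$, $L_F=\max_iL_i$, $\Omega_{\mathcal P}=\zeta/\phi$, where $\zeta$ is the smallest positive value of $d_i-C_iv$ over $v\in V$ and all rows $i$, and $\phi$ is the largest Euclidean norm of a row $C_i$ whose constraint is not active at every vertex. Let $N=p+1$ if the Carathéodory option below is used and $N=|V|$ otherwise, $\rho=\min\{\frac12,\ \Omega_{\mathcal P}^2\sigma_F/(16N^2L_FD^2)\}$ (with $\rho=\frac12$ if $\mathcal P$ is a single point), and $m^{(k)}=\lceil(1-\rho)^{-(2k+2)}\rceil$. Algorithm (Away-step Stochastic Frank–Wolfe, ASFW). Start at a vertex $x^{(1)}\in V$ with $U^{(1)}=\{x^{(1)}\}$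 and weights $\mu_{x^{(1)}}=1$, $\mu_v=0$ for the other vertices. For $k=1,2,\dots$: draw indices $\xi_1,\dots,\xi_{m^{(k)}}$ uniformly from $\{1,\dots,n\}$, all draws of all iterations being independent; put $F^{(k)}=\frac1{m^{(k)}}\sum_if_{\xi_i}$, $g=\nabla F^{(k)}(x^{(k)})$, $L^{(k)}=\frac1{m^{(k)}}\sum_iL_{\xi_i}$. Choose a vertex $w\in V$ minimizing $\langle g,\cdot\rangle$ over $\mathcal P$ and $u\in U^{(k)}$ maximizing $\langle g,\cdot\rangle$ over $U^{(k)}$. If $\langle g,w+u-2x^{(k)}\rangle\le0$ let $\delta=w-x^{(k)}$, $\gamma_{\max}=1$ (Frank–Wolfe step); otherwise let $\delta=x^{(k)}-u$, $\gamma_{\max}=\mu_u/(1-\mu_u)$ (away step). Take $\gamma=\min\{-\langle g,\delta\rangle/(L^{(k)}\|\delta\|^2),\gamma_{\max}\}$ ($0/0$ read as $0$), or $\gamma$ a minimizer of $F^{(k)}(x^{(k)}+\gamma\delta)$ over $[0,\gamma_{\max}]$, and set $x^{(k+1)}=x^{(k)}+\gamma\delta$. In an away step, multiply $\mu_v$ by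 $1+\gamma$ for $v\neq u$, replace $\mu_u$ by $\mu_u(1+\gamma)-\gamma$, and remove $u$ from $U$ if its new weight is $0$. In a Frank–Wolfe step, multiply $\mu_v$ by $1-\gamma$ for $v\ne w$, replace $\mu_w$ by $\mu_w(1-\gamma)+\gamma$, and set $U=\{w\}$ if the new $\mu_w$ is $1$, otherwise add $w$ to $U$. With the Carathéodory option, $(U,\mu)$ is then replaced by a representation of $x^{(k+1)}$ as a convex combination of at most $p+1$ elements of $U$. Ties may be broken arbitrarily, as long as every $x^{(k)}$ is a random vector. Statement. (1) There are constants $0<\beta<\rho$ and $C_2$, depending only on the problem (and on whether the Carathéodory option is used), such that every sequence generated by ASFW satisfies $$\mathbb E\{F(x^{(k+1)})-F^*\}\le C_2(1-\beta)^{(k-1)/2}\qquad(k\ge1),$$ and there is some $0<\omega<\beta$ such that, for every sequence generated by ASFW, almost surely $$\frac{F(x^{(k)})-F^*}{(1-\omega)^{(k-1)/2}}\longrightarrow0\qquad(k\to\infty);$$ therefore $F(x^{(k)})$ converges linearly to $F^*$ almost surely, i.e. almost surely there are $r\in(0,1)$ and $c$ with $|F(x^{(k)})-F^*|\le c\,r^k$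 for all $k\ge1$. (2) In general, linear convergence in expectation implies linear convergence almost surely: if $Y_1,Y_2,\dots$ are integrable random variables on a probability space, $l,C\in\mathbb R$, $0<r<1$ and $\mathbb E|Y_k-l|\le C\,r^k$ for all $k\ge1$, then for every $s\in(r,1)$, almost surely $(Y_k-l)/s^k\to0$ and $Y_k$ converges linearly to $l$. -/

import Mathlib

open MeasureTheory ProbabilityTheory Filter Topology
open scoped NNReal ENNReal Matrix RealInnerProductSpace

noncomputable section

namespace ASFW

/-- Euclidean space `ℝᵖ`. -/
abbrev Vec (p : ℕ) : Type := EuclideanSpace ℝ (Fin p)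

/-- Data of the problem `min_{x ∈ 𝒫} F x`, `F = (1/n) ∑ᵢ fᵢ`: a non-empty compact polyhedron
`𝒫 = {x | C x ≤ d}` and `n ≥ 1` differentiable functions `fᵢ : ℝᵖ → ℝ`, where `fᵢ` is strongly
convex with parameter `σᵢ > 0` and has an `Lᵢ`-Lipschitz gradient. -/
structure Problem (n p q : ℕ) where
  C : Matrix (Fin q) (Fin p) ℝ
  d : Fin q → ℝ
  f : Fin n → Vec p → ℝ
  σ : Fin n → ℝ
  L : Fin n → ℝ≥0
  n_pos : 0 < n
  nonempty_polytope : {x : Vec p | ∀ i, (C *ᵥ x.ofLp) i ≤ d i}.Nonempty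
  compact_polytope : IsCompact {x : Vec p | ∀ i, (C *ᵥ x.ofLp) i ≤ d i}
  σ_pos : ∀ i, 0 < σ i
  strongConvex : ∀ i, StrongConvexOn Set.univ (σ i) (f i)
  differentiable : ∀ i, Differentiable ℝ (f i)
  lipschitz_gradient : ∀ i, LipschitzWith (L i) (gradient (f i))

namespace Problem

variable {n p q : ℕ} (Q : Problem n p q)

/-- The polytope `𝒫`. -/
def polytope : Set (Vec p) := {x | ∀ i, (Q.C *ᵥ x.ofLp) i ≤ Q.d i}

/-- The set `V` of vertices (extreme points) of `𝒫`. -/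
def vertices : Set (Vec p) := Set.extremePoints ℝ Q.polytope

/-- The objective `F = (1/n) ∑ᵢ fᵢ`. -/
def F (x : Vec p) : ℝ := (1 / (n : ℝ)) * ∑ i, Q.f i x

/-- The optimal value `F*`. -/
def optValue : ℝ := sInf (Q.F '' Q.polytope)

/-- `ζ`: the smallest positive slack `dᵢ - Cᵢ v` at a vertex `v`. -/
def zeta : ℝ :=
  sInf {t | ∃ v ∈ Q.vertices, ∃ i, (Q.C *ᵥ v.ofLp) i < Q.d i ∧ t = Q.d i - (Q.C *ᵥ v.ofLp) i}

/-- `I(V)`: the constraints that are active at every vertex. -/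
def activeAtAll : Set (Fin q) := {i | ∀ v ∈ Q.vertices, (Q.C *ᵥ v.ofLp) i = Q.d i}

/-- `φ`: the largest Euclidean norm of a row `Cᵢ` with `i ∉ I(V)`. -/
def phi : ℝ :=
  sSup {t | ∃ i, i ∉ Q.activeAtAll ∧ t = ‖(WithLp.toLp 2 (Q.C i) : Vec p)‖}

/-- `Ω_𝒫 = ζ / φ`. -/
def Omega : ℝ := Q.zeta / Q.phi

/-- `σ_F = min σᵢ`. -/
def sigmaF : ℝ := ⨅ i, Q.σ i

/-- `L_F = max Lᵢ`. -/
def LF : ℝ := ⨆ i, (Q.L i : ℝ)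

/-- The diameter `D` of `𝒫`. -/
def D : ℝ := Metric.diam Q.polytope

/-- The bound `N` on the number of vertices in the representation of an iterate: `p + 1` if
Carathéodory's theorem is used in the update of the representation, `|V|` otherwise. -/
def N (car : Bool) : ℕ := if car then p + 1 else Q.vertices.ncard

open Classical in
/-- `ρ = min {1/2, Ω² σ_F / (16 N² L_F D²)}`; when `𝒫` is a single point, `D = 0` and the quotient
is read as `+∞`, so that `ρ = 1/2`. -/
def rho (car : Bool) : ℝ :=
  if Q.polytope.Subsingleton then 1 / 2
  else min (1 / 2) (Q.Omega ^ 2 * Q.sigmaF / (16 * (Q.N car : ℝ) ^ 2 * Q.LF * Q.D ^ 2))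

/-- The batch size `m⁽ᵏ⁾ = ⌈1 / (1 - ρ) ^ (2 k + 2)⌉`. -/
def batchSize (car : Bool) (k : ℕ) : ℕ := ⌈1 / (1 - Q.rho car) ^ (2 * k + 2)⌉₊

/-- `F⁽ᵏ⁾ = (1/m) ∑ᵢ f_{ξᵢ}` for a batch `ξ₁, …, ξₘ`. -/
def batchF {m : ℕ} (ξ : Fin m → Fin n) (x : Vec p) : ℝ := (1 / (m : ℝ)) * ∑ i, Q.f (ξ i) x

/-- The stochastic gradient `(1/m) ∑ᵢ ∇f_{ξᵢ}(x)`. -/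
def batchGrad {m : ℕ} (ξ : Fin m → Fin n) (x : Vec p) : Vec p :=
  (1 / (m : ℝ)) • ∑ i, gradient (Q.f (ξ i)) x

/-- `L⁽ᵏ⁾ = (1/m) ∑ᵢ L_{ξᵢ}`. -/
def batchL {m : ℕ} (ξ : Fin m → Fin n) : ℝ := (1 / (m : ℝ)) * ∑ i, (Q.L (ξ i) : ℝ)

/-- The admissible step lengths: the adaptive one, or one found by exact line-search for the
sampled objective on `[0, γmax]`. -/
def IsStepLength {m : ℕ} (ξ : Fin m → Fin n) (x dir : Vec p) (γmax γ : ℝ) : Prop :=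
  γ = min (-⟪Q.batchGrad ξ x, dir⟫ / (Q.batchL ξ * ‖dir‖ ^ 2)) γmax ∨
  (γ ∈ Set.Icc 0 γmax ∧ IsMinOn (fun t : ℝ => Q.batchF ξ (x + t • dir)) (Set.Icc 0 γmax) γ)

end Problem

/-- The state of the algorithm: the iterate `x`, the active vertices `U`, and the weights `μ`
(defined on all of `ℝᵖ`, and zero outside `U` along the algorithm). -/
structure State (p : ℕ) where
  x : Vec p
  U : Finset (Vec p)
  μ : Vec p → ℝ

open Classical in
/-- The initial state at a vertex `x₁`. -/
def State.initial {p : ℕ} (x₁ : Vec p) : State p where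
  x := x₁
  U := {x₁}
  μ := fun v => if v = x₁ then 1 else 0

open Classical in
/-- The result of an away step from the vertex `u` with length `γ`. -/
def State.away {p : ℕ} (S : State p) (u : Vec p) (γ : ℝ) : State p where
  x := S.x + γ • (S.x - u)
  U := if S.μ u * (1 + γ) - γ = 0 then S.U.erase u else S.U
  μ := fun v => if v = u then S.μ u * (1 + γ) - γ else S.μ v * (1 + γ)

open Classical in
/-- The result of a Frank-Wolfe step towards the vertex `w` with length `γ`. -/
def State.forward {p : ℕ} (S : State p) (w : Vec p) (γ : ℝ) : State p where
  x := S.x + γ • (w - S.x)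
  U := if S.μ w * (1 - γ) + γ = 1 then {w} else insert w S.U
  μ := fun v => if v = w then S.μ w * (1 - γ) + γ else S.μ v * (1 - γ)

/-- `T` arises from `S` by applying Carathéodory's theorem to the representation of the iterate:
the same point, as a convex combination of at most `p + 1` of the active vertices. -/
structure State.IsReduction {p : ℕ} (S T : State p) : Prop where
  same_x : T.x = S.x
  subset : T.U ⊆ S.U
  card_le : T.U.card ≤ p + 1
  nonneg : ∀ v, 0 ≤ T.μ v
  support : ∀ v, v ∉ T.U → T.μ v = 0
  sum_one : ∑ v ∈ T.U, T.μ v = 1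
  repr : ∑ v ∈ T.U, T.μ v • v = T.x

/-- Conclusion of an iteration: `R` is the state after the plain update of the representation,
`T` the state handed to the next iteration. -/
def State.Finish {p : ℕ} (car : Bool) (R T : State p) : Prop :=
  if car then R.IsReduction T else T = R

/-- One iteration of the Away-step Stochastic Frank-Wolfe algorithm with the batch `ξ`,
from the state `S` to the state `T`. -/
def Problem.Step {n p q : ℕ} (Q : Problem n p q) (car : Bool) {m : ℕ} (ξ : Fin m → Fin n)
    (S T : State p) : Prop :=
  ∃ w ∈ Q.vertices, ∃ u ∈ S.U,
    (∀ y ∈ Q.polytope, ⟪Q.batchGrad ξ S.x, w⟫ ≤ ⟪Q.batchGrad ξ S.x, y⟫) ∧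
    (∀ v ∈ S.U, ⟪Q.batchGrad ξ S.x, v⟫ ≤ ⟪Q.batchGrad ξ S.x, u⟫) ∧
    ((⟪Q.batchGrad ξ S.x, w + u - (2 : ℝ) • S.x⟫ ≤ 0 ∧
        ∃ γ, Q.IsStepLength ξ S.x (w - S.x) 1 γ ∧ (S.forward w γ).Finish car T) ∨
      (0 < ⟪Q.batchGrad ξ S.x, w + u - (2 : ℝ) • S.x⟫ ∧
        ∃ γ, Q.IsStepLength ξ S.x (S.x - u) (S.μ u / (1 - S.μ u)) γ ∧
          (S.away u γ).Finish car T))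

/-- `S 1, S 2, …` is a random sequence of states generated by the Away-step Stochastic Frank-Wolfe
algorithm from the samples `ξ k i`, `k ≥ 1`, `i < m⁽ᵏ⁾`, which are independent and uniform on the
`n` indices. Entries with `k = 0` play no role. -/
structure Problem.IsASFW {n p q : ℕ} (Q : Problem n p q) (car : Bool)
    {Ω : Type*} [MeasurableSpace Ω] (P : Measure Ω)
    (ξ : (k : ℕ) → Fin (Q.batchSize car k) → Ω → Fin n) (S : ℕ → Ω → State p) : Prop where
  measurable_sample : ∀ k, 1 ≤ k → ∀ i, Measurable (ξ k i)
  uniform_sample : ∀ k, 1 ≤ k → ∀ i j, P {a | ξ k i a = j} = (n : ℝ≥0∞)⁻¹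
  indep_sample : iIndepFun
    (fun s : {s : Σ k : ℕ, Fin (Q.batchSize car k) // 1 ≤ s.1} => ξ s.1.1 s.1.2) P
  measurable_iterate : ∀ k, 1 ≤ k → Measurable fun a => (S k a).x
  start : ∃ x₁ ∈ Q.vertices, ∀ a, S 1 a = State.initial x₁
  step : ∀ k, 1 ≤ k → ∀ a, Q.Step car (fun i => ξ k i a) (S k a) (S (k + 1) a)

/-- Linear convergence of a real sequence: `|a k - l| = O(r ^ k)` for some `r ∈ (0, 1)`. -/
def ConvergesLinearly (a : ℕ → ℝ) (l : ℝ) : Prop :=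
  ∃ r : ℝ, 0 < r ∧ r < 1 ∧ ∃ C : ℝ, ∀ k, 1 ≤ k → |a k - l| ≤ C * r ^ k

end ASFW

end

/-! For a fixed batch the sampled objective is strongly convex with modulus `sigmaF`. A Hoffman-type
constant `K` of the vertex set then bounds its suboptimality at an iterate by the squared spread of
the sampled gradient between the active vertices and all vertices (`exists_inner_sub_le`,
`exists_gap_bound`). The chosen direction captures at least half of that spread, so smoothness turns
it into a decrease by a fixed factor `1 - κ`. The only exception is an away step of maximal length,
which does not increase the sampled objective and removes an active vertex (`exists_contraction`).

These drop steps are absorbed by the potential (suboptimality) * `B ^ |U|` with `B = 1 / √(1 - κ)`.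
A contracting step gains `1 - κ` and loses at most one factor `B`; a drop step gains a factor `1 /
B`. Up to noise, both multiply the potential by at most `b = √(1 - κ)` (`potential_step`).

Replacing the sampled objective by `F` costs an error that is uniform on the polytope: the
difference is a combination of the finitely many `f j`, with the errors of the empirical frequencies
as coefficients (`abs_batchF_sub_F_le`). Hence the recursion holds on every path, however the next
iterate depends on the batch (`exists_majorant`). The expected frequency error is `O(1 / √m)`, which
decays geometrically for the prescribed batch sizes, and so does the expected suboptimality
(`exists_expected_rate`). Apart from its role in the batch sizes, `ρ` enters only through `0 < ρ ≤
1/2`, because `β` may be taken as small as needed.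

Almost sure convergence follows by rescaling with a slower geometric rate: the expectations become
summable, so the random series is almost surely finite and its terms tend to zero
(`ae_tendsto_div_pow`). -/

namespace ASFW

/-! ### Smooth and strongly convex functions. -/

section Smooth

variable {E : Type*} [NormedAddCommGroup E] [InnerProductSpace ℝ E] [CompleteSpace E]

theorem hasDerivAt_comp_line {f : E → ℝ} (hf : Differentiable ℝ f) (x δ : E) (t : ℝ) :
    HasDerivAt (fun t : ℝ => f (x + t • δ)) ⟪gradient f (x + t • δ), δ⟫ t := by
  have h1 : HasDerivAt (fun t : ℝ => x + t • δ) δ t := by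
    simpa using ((hasDerivAt_id t).smul_const δ).const_add x
  have h2 := (hf (x + t • δ)).hasFDerivAt.comp_hasDerivAt t h1
  rw [inner_gradient_left]
  exact h2

/-- The quadratic lower bound for a strongly convex function. -/
theorem StrongConvexOn.add_inner_gradient_add_le {f : E → ℝ} {m : ℝ}
    (hc : StrongConvexOn Set.univ m f) (hf : Differentiable ℝ f) (x y : E) :
    f x + ⟪gradient f x, y - x⟫ + m / 2 * ‖y - x‖ ^ 2 ≤ f y := by
  have hd := hasDerivAt_comp_line hf x (y - x) 0
  have h1 := hd.tendsto_slope_zero_right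
  simp only [zero_add, zero_smul, add_zero, smul_eq_mul] at h1
  -- Strong convexity on the segment, divided by `t`, bounds the difference quotient by this
  -- expression; the claim is the limit `t → 0+`.
  have h2 : Tendsto (fun t : ℝ => f y - f x - (1 - t) * (m / 2 * ‖y - x‖ ^ 2)) (𝓝[>] 0)
      (𝓝 (f y - f x - (1 - 0) * (m / 2 * ‖y - x‖ ^ 2))) := by
    apply Tendsto.mono_left _ nhdsWithin_le_nhds
    exact Continuous.tendsto (by fun_prop) 0
  have h3 := le_of_tendsto_of_tendsto h1 h2 (by
    filter_upwards [Ioo_mem_nhdsGT (zero_lt_one (α := ℝ))] with t ht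
    have h := hc.2 (Set.mem_univ x) (Set.mem_univ y) (sub_nonneg.2 ht.2.le) ht.1.le (by ring)
    have e : (1 - t) • x + t • y = x + t • (y - x) := by module
    rw [e, norm_sub_rev x y] at h
    simp only [smul_eq_mul] at h
    rw [inv_mul_le_iff₀ ht.1]
    nlinarith)
  linarith

/-- The descent lemma along a ray. -/
theorem le_of_lipschitzWith_gradient {f : E → ℝ} {L : ℝ≥0} (hf : Differentiable ℝ f)
    (hL : LipschitzWith L (gradient f)) (x δ : E) {t : ℝ} (ht : 0 ≤ t) :
    f (x + t • δ) ≤ f x + t * ⟪gradient f x, δ⟫ + L * ‖δ‖ ^ 2 / 2 * t ^ 2 := by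
  set φ : ℝ → ℝ := fun t => f (x + t • δ) - t * ⟪gradient f x, δ⟫ - L * ‖δ‖ ^ 2 / 2 * t ^ 2
  have hφ : ∀ t, HasDerivAt φ
      (⟪gradient f (x + t • δ), δ⟫ - ⟪gradient f x, δ⟫ - L * ‖δ‖ ^ 2 * t) t := by
    intro t
    have h := ((hasDerivAt_comp_line hf x δ t).sub
      ((hasDerivAt_id t).mul_const ⟪gradient f x, δ⟫)).sub
      (((hasDerivAt_id t).pow 2).const_mul ((L : ℝ) * ‖δ‖ ^ 2 / 2))
    refine h.congr_deriv ?_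
    norm_num
    ring
  have hanti : AntitoneOn φ (Set.Ici 0) := by
    apply antitoneOn_of_deriv_nonpos (convex_Ici 0)
    · exact fun t _ => (hφ t).continuousAt.continuousWithinAt
    · exact fun t _ => (hφ t).differentiableAt.differentiableWithinAt
    · intro t ht
      rw [interior_Ici, Set.mem_Ioi] at ht
      rw [(hφ t).deriv, ← inner_sub_left]
      have h1 := real_inner_le_norm (gradient f (x + t • δ) - gradient f x) δ
      have h2 := hL.norm_sub_le (x + t • δ) x
      rw [add_sub_cancel_left, norm_smul, Real.norm_of_nonneg ht.le] at h2
      have h3 := mul_le_mul_of_nonneg_right h2 (norm_nonneg δ)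
      nlinarith
  have := hanti (Set.mem_Ici.2 le_rfl) ht ht
  simp only [φ, zero_smul, add_zero, zero_mul, sub_zero] at this
  nlinarith

/-- The quadratic lower and upper bounds at `y` are compared. Two distinct points are needed: on a
trivial space every modulus is admissible. -/
theorem strongConvexity_le_lipschitz {f : E → ℝ} {m : ℝ} {L : ℝ≥0}
    (hc : StrongConvexOn Set.univ m f) (hf : Differentiable ℝ f)
    (hL : LipschitzWith L (gradient f)) {x y : E} (hxy : x ≠ y) : m ≤ L := by
  have h1 := StrongConvexOn.add_inner_gradient_add_le hc hf x y
  have h2 := le_of_lipschitzWith_gradient hf hL x (y - x) zero_le_one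
  have hpos : 0 < ‖y - x‖ ^ 2 := by
    have := norm_pos_iff.2 (sub_ne_zero.2 hxy.symm)
    positivity
  simp only [one_smul, add_sub_cancel, one_mul, one_pow, mul_one] at h2
  by_contra hlt
  push Not at hlt
  nlinarith

end Smooth

/-! ### Bounded conic representations and a Hoffman-type inequality. -/

section Conic

variable {ι E : Type*} [Fintype ι] [NormedAddCommGroup E] [NormedSpace ℝ E]

/-- An injective linear map on a finite-dimensional space is bounded below; the coefficient sum is
at most the number of coefficients times the sup norm. -/
theorem exists_sum_le_norm_of_injOn (g : ι → E) (t : Finset ι)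
    (ht : ∀ z : ι → ℝ, (∀ i ∉ t, z i = 0) → ∑ i, z i • g i = 0 → z = 0) :
    ∃ K : ℝ, 0 ≤ K ∧ ∀ z : ι → ℝ, (∀ i ∉ t, z i = 0) → ∑ i, z i ≤ K * ‖∑ i, z i • g i‖ := by
  let W : Submodule ℝ (ι → ℝ) :=
    { carrier := {z | ∀ i ∉ t, z i = 0}
      add_mem' := fun {a b} ha hb i hi => by simp [ha i hi, hb i hi]
      zero_mem' := fun i _ => rfl
      smul_mem' := fun r a ha i hi => by simp [ha i hi] }
  let T : W →ₗ[ℝ] E := (Fintype.linearCombination ℝ g).comp W.subtype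
  have hT : ∀ z : W, T z = ∑ i, z.1 i • g i := fun z => by
    simp [T, Fintype.linearCombination_apply]
  have hker : LinearMap.ker T = ⊥ := by
    rw [LinearMap.ker_eq_bot']
    intro z hz
    rw [hT] at hz
    exact Subtype.ext (ht z.1 z.2 hz)
  obtain ⟨K, -, hK⟩ := T.exists_antilipschitzWith hker
  refine ⟨Fintype.card ι * K, by positivity, fun z hz => ?_⟩
  have h1 := hK.le_mul_dist ⟨z, hz⟩ 0
  rw [dist_zero_right, map_zero, dist_zero_right, hT] at h1
  have h2 : ∑ i, z i ≤ ∑ _i : ι, ‖z‖ :=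
    Finset.sum_le_sum fun i _ => (le_abs_self _).trans (norm_le_pi_norm z i)
  rw [Finset.sum_const, nsmul_eq_mul, Finset.card_univ] at h2
  have h3 : ‖z‖ ≤ K * ‖∑ i, z i • g i‖ := h1
  calc _ ≤ _ := h2
    _ ≤ Fintype.card ι * (K * ‖∑ i, z i • g i‖) := by gcongr
    _ = _ := by ring

open Classical in
/-- Carathéodory's theorem for cones: reduction to an independent support. -/
theorem exists_conic_independent (g : ι → E) (c : ι → ℝ) (hc : ∀ i, 0 ≤ c i) :
    ∃ c' : ι → ℝ, (∀ i, 0 ≤ c' i) ∧ (∀ i, c i = 0 → c' i = 0) ∧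
      ∑ i, c' i • g i = ∑ i, c i • g i ∧
      ∀ z : ι → ℝ, (∀ i, c' i = 0 → z i = 0) → ∑ i, z i • g i = 0 → z = 0 := by
  induction hN : (Finset.univ.filter fun i => c i ≠ 0).card using Nat.strong_induction_on
    generalizing c with
  | _ N ih =>
  by_cases hind : ∀ z : ι → ℝ, (∀ i, c i = 0 → z i = 0) → ∑ i, z i • g i = 0 → z = 0
  · exact ⟨c, hc, fun _ h => h, rfl, hind⟩
  push Not at hind
  obtain ⟨z, hz, hzg, hne, hpos⟩ : ∃ z : ι → ℝ, (∀ i, c i = 0 → z i = 0) ∧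
      ∑ i, z i • g i = 0 ∧ z ≠ 0 ∧ ∃ i, 0 < z i := by
    obtain ⟨z, hz, hzg, hne⟩ := hind
    obtain ⟨i, hi⟩ := Function.ne_iff.1 hne
    rcases lt_or_gt_of_ne hi with h | h
    · refine ⟨-z, fun j hj => by simp [hz j hj], by simp [hzg], by simpa using hne, i, ?_⟩
      simpa using h
    · exact ⟨z, hz, hzg, hne, i, h⟩
  have hsne : (Finset.univ.filter fun i => 0 < z i).Nonempty := by
    obtain ⟨i, hi⟩ := hpos
    exact ⟨i, by simpa using hi⟩
  -- The minimal ratio is the largest multiple of the relation `z` that can be subtracted with all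
  -- coefficients staying nonnegative; it annihilates the coefficient of `j`.
  obtain ⟨j, hj, hmin⟩ := Finset.exists_min_image _ (fun i => c i / z i) hsne
  simp only [Finset.mem_filter, Finset.mem_univ, true_and] at hj hmin
  set c₁ : ι → ℝ := fun i => c i - c j / z j * z i with hc₁
  have hq : 0 ≤ c j / z j := div_nonneg (hc j) hj.le
  have h0 : ∀ i, 0 ≤ c₁ i := by
    intro i
    simp only [hc₁, sub_nonneg]
    rcases lt_or_ge 0 (z i) with h | h
    · exact (le_div_iff₀ h).1 (hmin i h)
    · exact (mul_nonpos_of_nonneg_of_nonpos hq h).trans (hc i)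
  have hs : ∀ i, c i = 0 → c₁ i = 0 := fun i hi => by simp [hc₁, hi, hz i hi]
  have hsum : ∑ i, c₁ i • g i = ∑ i, c i • g i := by
    simp only [hc₁, sub_smul, Finset.sum_sub_distrib, mul_smul, ← Finset.smul_sum, hzg]
    simp
  have hlt : (Finset.univ.filter fun i => c₁ i ≠ 0).card < N := by
    rw [← hN]
    apply Finset.card_lt_card
    rw [Finset.ssubset_iff_of_subset]
    · refine ⟨j, ?_, ?_⟩
      · simp only [Finset.mem_filter, Finset.mem_univ, true_and]
        exact fun h => hj.ne' (hz j h)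
      · simp only [Finset.mem_filter, Finset.mem_univ, true_and, not_not, hc₁]
        field_simp
        ring
    · intro i
      simp only [Finset.mem_filter, Finset.mem_univ, true_and]
      exact fun h h' => h (hs i h')
  obtain ⟨c', h1, h2, h3, h4⟩ := ih _ hlt c₁ h0 rfl
  exact ⟨c', h1, fun i hi => h2 i (hs i hi), h3.trans hsum, h4⟩

open Classical in
/-- Points of a finitely generated cone have conic representations of size bounded by a multiple
of their norm, using only the generators of any given representation. -/
theorem exists_conic_bound (g : ι → E) :
    ∃ K : ℝ, 0 ≤ K ∧ ∀ c : ι → ℝ, (∀ i, 0 ≤ c i) → ∃ c' : ι → ℝ, (∀ i, 0 ≤ c' i) ∧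
      (∀ i, c i = 0 → c' i = 0) ∧ ∑ i, c' i • g i = ∑ i, c i • g i ∧
      ∑ i, c' i ≤ K * ‖∑ i, c i • g i‖ := by
  -- There is one constant per possible support. Dependent supports get the dummy value `0`, and the
  -- finitely many constants are summed at the end.
  have H : ∀ t : Finset ι, ∃ K : ℝ, 0 ≤ K ∧
      ((∀ z : ι → ℝ, (∀ i ∉ t, z i = 0) → ∑ i, z i • g i = 0 → z = 0) →
        ∀ z : ι → ℝ, (∀ i ∉ t, z i = 0) → ∑ i, z i ≤ K * ‖∑ i, z i • g i‖) := by
    intro t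
    by_cases ht : ∀ z : ι → ℝ, (∀ i ∉ t, z i = 0) → ∑ i, z i • g i = 0 → z = 0
    · obtain ⟨K, h0, hK⟩ := exists_sum_le_norm_of_injOn g t ht
      exact ⟨K, h0, fun _ => hK⟩
    · exact ⟨0, le_rfl, fun h => absurd h ht⟩
  choose K hK0 hK using H
  refine ⟨∑ t, K t, Finset.sum_nonneg fun t _ => hK0 t, fun c hc => ?_⟩
  obtain ⟨c', h1, h2, h3, h4⟩ := exists_conic_independent g c hc
  refine ⟨c', h1, h2, h3, ?_⟩
  set t := Finset.univ.filter fun i => c' i ≠ 0 with ht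
  have hmem : ∀ i, i ∉ t ↔ c' i = 0 := fun i => by simp [ht]
  have h5 := hK t (fun z hz => h4 z fun i hi => hz i ((hmem i).2 hi)) c'
    fun i hi => (hmem i).1 hi
  rw [h3] at h5
  refine h5.trans ?_
  gcongr
  exact Finset.single_le_sum (f := K) (fun t _ => hK0 t) (Finset.mem_univ t)

end Conic

/-- For points `x` and `y` of a polytope with vertices in `V`, the gap `⟪g, x - y⟫` is controlled
by `‖x - y‖` times the spread of `⟪g, ·⟫` between the vertices representing `x` and all vertices. -/
theorem exists_inner_sub_le {E : Type*} [NormedAddCommGroup E] [InnerProductSpace ℝ E]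
    (V : Finset E) :
    ∃ K : ℝ, 0 ≤ K ∧ ∀ μ ν : E → ℝ, (∀ v ∈ V, 0 ≤ μ v) → (∀ v ∈ V, 0 ≤ ν v) →
      ∑ v ∈ V, μ v = 1 → ∑ v ∈ V, ν v = 1 → ∀ (g : E) (α β : ℝ),
      (∀ v ∈ V, μ v ≠ 0 → ⟪g, v⟫ ≤ α) → (∀ v ∈ V, β ≤ ⟪g, v⟫) →
      ⟪g, (∑ v ∈ V, μ v • v) - ∑ v ∈ V, ν v • v⟫ ≤
        K * ‖(∑ v ∈ V, μ v • v) - ∑ v ∈ V, ν v • v‖ * (α - β) := by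
  -- The extra coordinate `±1` forces the positive and negative parts of any new representation of
  -- `x - y` to have equal mass `θ`. The norm bound then makes `θ` at most `K * ‖x - y‖`, and the
  -- support condition keeps the positive part on vertices with `μ v ≠ 0`.
  let G : V ⊕ V → E × ℝ := Sum.elim (fun v => (v.1, 1)) fun v => (-v.1, -1)
  obtain ⟨K, hK0, hK⟩ := exists_conic_bound G
  refine ⟨K, hK0, fun μ ν hμ hν hμ1 hν1 g α β hα hβ => ?_⟩
  obtain ⟨c, hc, hc0, hcs, hcK⟩ := hK (Sum.elim (fun v => μ v.1) fun v => ν v.1) (by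
    rintro (v | v)
    · exact hμ v v.2
    · exact hν v v.2)
  have hs : ∀ c : V ⊕ V → ℝ, ∑ i, c i • G i =
      (∑ v : V, c (.inl v) • v.1 - ∑ v : V, c (.inr v) • v.1,
        ∑ v : V, c (.inl v) - ∑ v : V, c (.inr v)) := by
    intro c
    rw [Fintype.sum_sum_type]
    ext
    · simp [G, Prod.fst_sum, sub_eq_add_neg]
    · simp [G, Prod.snd_sum, sub_eq_add_neg]
  set x := ∑ v ∈ V, μ v • v with hx
  set y := ∑ v ∈ V, ν v • v with hy
  have hcx : ∑ i, (Sum.elim (fun v : V => μ v.1) (fun v : V => ν v.1) i) • G i = (x - y, 0) := by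
    rw [hs]
    simp only [Sum.elim_inl, Sum.elim_inr]
    rw [Finset.sum_coe_sort V fun v => μ v • v, Finset.sum_coe_sort V fun v => ν v • v,
      Finset.sum_coe_sort V μ, Finset.sum_coe_sort V ν, hμ1, hν1, sub_self]
  rw [hcx] at hcs hcK
  rw [hs, Prod.mk.injEq] at hcs
  obtain ⟨h1, h2⟩ := hcs
  have hnorm : ‖((x - y, (0 : ℝ)) : E × ℝ)‖ = ‖x - y‖ := by simp [Prod.norm_def]
  rw [hnorm, Fintype.sum_sum_type] at hcK
  set θ := ∑ v : V, c (.inl v) with hθ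
  have hθ' : ∑ v : V, c (.inr v) = θ := by linarith
  have hθ0 : 0 ≤ θ := Finset.sum_nonneg fun v _ => hc _
  have hαβ : β ≤ α := by
    obtain ⟨v, hv, hne⟩ := Finset.exists_ne_zero_of_sum_ne_zero (by rw [hμ1]; exact one_ne_zero)
    exact (hβ v hv).trans (hα v hv hne)
  have h3 : ⟪g, ∑ v : V, c (.inl v) • v.1⟫ ≤ θ * α := by
    rw [inner_sum, hθ, Finset.sum_mul]
    refine Finset.sum_le_sum fun v _ => ?_
    rw [real_inner_smul_right]
    by_cases hv : μ v.1 = 0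
    · rw [hc0 (.inl v) hv]; simp
    · exact mul_le_mul_of_nonneg_left (hα v v.2 hv) (hc _)
  have h4 : θ * β ≤ ⟪g, ∑ v : V, c (.inr v) • v.1⟫ := by
    rw [inner_sum, ← hθ', Finset.sum_mul]
    refine Finset.sum_le_sum fun v _ => ?_
    rw [real_inner_smul_right]
    exact mul_le_mul_of_nonneg_left (hβ v v.2) (hc _)
  rw [← h1, inner_sub_right, h1]
  have h5 : θ ≤ K * ‖x - y‖ := by linarith
  have h6 := mul_le_mul_of_nonneg_right h5 (sub_nonneg.2 hαβ)
  linarith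

end ASFW

/-! ### Geometry of the polytope and positivity of the constants. -/

namespace ASFW.Problem

variable {n p q : ℕ} (Q : Problem n p q)

/-- The `i`-th row of the constraint matrix, as a linear functional. -/
def row (i : Fin q) : Vec p →ₗ[ℝ] ℝ :=
  (LinearMap.proj i).comp (Q.C.mulVecLin.comp (WithLp.linearEquiv 2 ℝ (Fin p → ℝ)).toLinearMap)

theorem row_apply (i : Fin q) (x : Vec p) : Q.row i x = (Q.C *ᵥ x.ofLp) i := rfl

theorem mem_polytope {x : Vec p} : x ∈ Q.polytope ↔ ∀ i, Q.row i x ≤ Q.d i := Iff.rfl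

theorem polytope_nonempty : Q.polytope.Nonempty := Q.nonempty_polytope

theorem isCompact_polytope : IsCompact Q.polytope := Q.compact_polytope

theorem convex_polytope : Convex ℝ Q.polytope := by
  intro x hx y hy a b ha hb hab
  rw [mem_polytope] at *
  intro i
  rw [map_add, map_smul, map_smul, smul_eq_mul, smul_eq_mul]
  calc _ ≤ a * Q.d i + b * Q.d i :=
        add_le_add (mul_le_mul_of_nonneg_left (hx i) ha) (mul_le_mul_of_nonneg_left (hy i) hb)
    _ = Q.d i := by rw [← add_mul, hab, one_mul]

theorem vertices_subset : Q.vertices ⊆ Q.polytope := extremePoints_subset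

/-- A vertex is determined by its set of active constraints. -/
theorem eq_of_active_iff {v w : Vec p} (hv : v ∈ Q.vertices) (hw : w ∈ Q.vertices)
    (h : ∀ i, Q.row i v = Q.d i ↔ Q.row i w = Q.d i) : v = w := by
  by_contra hne
  have hvP := Q.vertices_subset hv
  have hwP := Q.vertices_subset hw
  rw [mem_polytope] at hvP hwP
  -- Moving from `v` slightly away from `w` violates nothing: common active constraints are constant
  -- along the line and the others have slack. So `v` is interior to a segment, against extremality.
  have key : ∀ᶠ t : ℝ in 𝓝[>] 0, v - t • (w - v) ∈ Q.polytope := by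
    simp only [mem_polytope, eventually_all]
    intro i
    by_cases hi : Q.row i v = Q.d i
    · refine Eventually.of_forall fun t => ?_
      rw [map_sub, map_smul, map_sub, hi, (h i).1 hi]
      simp
    · have hlt : Q.row i v < Q.d i := lt_of_le_of_ne (hvP i) hi
      have hcont : Tendsto (fun t : ℝ => Q.row i v - t * (Q.row i w - Q.row i v)) (𝓝[>] 0)
          (𝓝 (Q.row i v - 0 * (Q.row i w - Q.row i v))) :=
        (Continuous.tendsto (by fun_prop) 0).mono_left nhdsWithin_le_nhds
      rw [zero_mul, sub_zero] at hcont
      filter_upwards [hcont.eventually_lt_const hlt] with t ht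
      rw [map_sub, map_smul, map_sub, smul_eq_mul]
      exact ht.le
  obtain ⟨t, htP, ht0⟩ := (key.and self_mem_nhdsWithin).exists
  replace ht0 : 0 < t := ht0
  have hseg : v ∈ openSegment ℝ w (v - t • (w - v)) := by
    refine ⟨t / (1 + t), 1 / (1 + t), by positivity, by positivity, by field_simp; ring, ?_⟩
    have h1 : (1 + t) ≠ 0 := by positivity
    rw [← sub_eq_zero]
    have : (t / (1 + t)) • w + (1 / (1 + t)) • (v - t • (w - v)) - v =
        ((1 + t) * (1 / (1 + t)) - 1) • v := by
      rw [show t / (1 + t) = t * (1 / (1 + t)) by ring]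
      module
    rw [this, mul_one_div_cancel h1]
    simp
  exact hne ((mem_extremePoints_iff_left.1 hv).2 w (Q.vertices_subset hw) _ htP hseg).symm

theorem finite_vertices : Q.vertices.Finite := by
  refine Set.Finite.of_injOn (f := fun v => {i | Q.row i v = Q.d i}) (t := Set.univ)
    (fun _ _ => Set.mem_univ _) (fun v hv w hw h => Q.eq_of_active_iff hv hw fun i => ?_)
    Set.finite_univ
  exact Set.ext_iff.1 h i

/-- Krein–Milman; finiteness of the vertex set makes the closure superfluous. -/
theorem convexHull_vertices : convexHull ℝ Q.vertices = Q.polytope := by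
  rw [← (Q.finite_vertices.isClosed_convexHull ℝ).closure_eq]
  exact closure_convexHull_extremePoints Q.isCompact_polytope Q.convex_polytope

theorem vertices_nonempty : Q.vertices.Nonempty :=
  Q.isCompact_polytope.extremePoints_nonempty Q.polytope_nonempty

theorem finite_slacks : {t | ∃ v ∈ Q.vertices, ∃ i, (Q.C *ᵥ v.ofLp) i < Q.d i ∧
    t = Q.d i - (Q.C *ᵥ v.ofLp) i}.Finite := by
  refine ((Q.finite_vertices.prod (Set.finite_univ (α := Fin q))).image
    fun a => Q.d a.2 - (Q.C *ᵥ a.1.ofLp) a.2).subset ?_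
  rintro t ⟨v, hv, i, -, rfl⟩
  exact ⟨(v, i), ⟨hv, Set.mem_univ _⟩, rfl⟩

/-- In a polytope with more than one point, some non-zero row is not active everywhere. -/
theorem exists_row_ne_zero (h : ¬ Q.polytope.Subsingleton) :
    ∃ i, i ∉ Q.activeAtAll ∧ Q.C i ≠ 0 := by
  by_contra! hcon
  obtain ⟨x, hx, y, hy, hne⟩ := Set.not_subsingleton_iff.1 h
  have hact : ∀ i ∈ Q.activeAtAll, ∀ z ∈ Q.polytope, Q.row i z = Q.d i := by
    intro i hi z hz
    have hc : Convex ℝ {z | Q.row i z = Q.d i} := convex_hyperplane (Q.row i).isLinear _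
    rw [← Q.convexHull_vertices] at hz
    exact convexHull_min (fun v hv => hi v hv) hc hz
  -- If every row not active everywhere vanished, the whole line through `x` and `y` would stay
  -- feasible, contradicting boundedness.
  have hline : ∀ t : ℝ, x + t • (y - x) ∈ Q.polytope := by
    intro t
    rw [mem_polytope]
    intro i
    by_cases hi : i ∈ Q.activeAtAll
    · rw [map_add, map_smul, map_sub, hact i hi x hx, hact i hi y hy]
      simp
    · have h0 : ∀ z, Q.row i z = 0 := fun z => by
        rw [row_apply, Matrix.mulVec, hcon i hi, zero_dotProduct]
      rw [h0, ← h0 x]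
      exact hx i
  obtain ⟨R, hR⟩ := Q.isCompact_polytope.isBounded.exists_norm_le
  have hpos : 0 < ‖y - x‖ := norm_pos_iff.2 (sub_ne_zero.2 hne.symm)
  have h1 := hR _ (hline ((R + ‖x‖ + 1) / ‖y - x‖))
  have hR0 : 0 ≤ R := (norm_nonneg x).trans (hR x hx)
  have h2 : ‖((R + ‖x‖ + 1) / ‖y - x‖) • (y - x)‖ = R + ‖x‖ + 1 := by
    rw [norm_smul, Real.norm_of_nonneg (by positivity), div_mul_cancel₀ _ hpos.ne']
  have h3 := norm_sub_norm_le (((R + ‖x‖ + 1) / ‖y - x‖) • (y - x)) (-x)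
  rw [norm_neg, sub_neg_eq_add, add_comm _ x] at h3
  linarith

theorem Omega_pos (h : ¬ Q.polytope.Subsingleton) : 0 < Q.Omega := by
  obtain ⟨i, hi, hCi⟩ := Q.exists_row_ne_zero h
  refine div_pos ?_ ?_
  · have hne : {t | ∃ v ∈ Q.vertices, ∃ i, (Q.C *ᵥ v.ofLp) i < Q.d i ∧
        t = Q.d i - (Q.C *ᵥ v.ofLp) i}.Nonempty := by
      simp only [activeAtAll, Set.mem_ofPred_eq, not_forall] at hi
      obtain ⟨v, hv, hvi⟩ := hi
      exact ⟨_, v, hv, i, lt_of_le_of_ne (Q.vertices_subset hv i) hvi, rfl⟩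
    obtain ⟨v, -, i, hlt, he⟩ := hne.csInf_mem Q.finite_slacks
    rw [zeta, he]
    exact sub_pos.2 hlt
  · have hfin : {t | ∃ i, i ∉ Q.activeAtAll ∧ t = ‖(WithLp.toLp 2 (Q.C i) : Vec p)‖}.Finite := by
      refine (Set.finite_range fun i => ‖(WithLp.toLp 2 (Q.C i) : Vec p)‖).subset ?_
      rintro t ⟨i, -, rfl⟩
      exact ⟨i, rfl⟩
    refine lt_of_lt_of_le ?_ (le_csSup hfin.bddAbove ⟨i, hi, rfl⟩)
    rw [norm_pos_iff]
    intro h0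
    exact hCi (by simpa using h0)

theorem sigmaF_pos : 0 < Q.sigmaF := by
  have : Nonempty (Fin n) := ⟨⟨0, Q.n_pos⟩⟩
  obtain ⟨i, hi⟩ := exists_eq_ciInf_of_finite (f := Q.σ)
  rw [sigmaF, ← hi]
  exact Q.σ_pos i

theorem sigmaF_le (i : Fin n) : Q.sigmaF ≤ Q.σ i := ciInf_le (Set.finite_range _).bddBelow i

theorem L_le_LF (i : Fin n) : (Q.L i : ℝ) ≤ Q.LF :=
  le_ciSup (f := fun i => (Q.L i : ℝ)) (Set.finite_range _).bddAbove i

theorem L_pos {x y : Vec p} (hxy : x ≠ y) (i : Fin n) : (0 : ℝ) < Q.L i :=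
  (Q.σ_pos i).trans_le
    (strongConvexity_le_lipschitz (Q.strongConvex i) (Q.differentiable i)
      (Q.lipschitz_gradient i) hxy)

theorem rho_le_half (car : Bool) : Q.rho car ≤ 1 / 2 := by
  unfold rho
  split_ifs
  · exact le_rfl
  · exact min_le_left _ _

theorem rho_pos (car : Bool) : 0 < Q.rho car := by
  unfold rho
  split_ifs with h
  · norm_num
  · obtain ⟨x, hx, y, hy, hne⟩ := Set.not_subsingleton_iff.1 h
    have hD : 0 < Q.D :=
      (dist_pos.2 hne).trans_le (Metric.dist_le_diam_of_mem Q.isCompact_polytope.isBounded hx hy)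
    have hL : 0 < Q.LF := (Q.L_pos hne ⟨0, Q.n_pos⟩).trans_le (Q.L_le_LF _)
    have hN : 0 < (Q.N car : ℝ) := by
      rw [N, Nat.cast_pos]
      split_ifs
      · exact Nat.succ_pos p
      · exact (Set.ncard_pos Q.finite_vertices).2 Q.vertices_nonempty
    have hO := Q.Omega_pos h
    have hs := Q.sigmaF_pos
    exact lt_min (by norm_num) (by positivity)

theorem norm_sub_le_D {x y : Vec p} (hx : x ∈ Q.polytope) (hy : y ∈ Q.polytope) :
    ‖x - y‖ ≤ Q.D := by
  rw [← dist_eq_norm]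
  exact Metric.dist_le_diam_of_mem Q.isCompact_polytope.isBounded hx hy

theorem continuous_F : Continuous Q.F := by
  unfold F
  have := fun i => (Q.differentiable i).continuous
  fun_prop

theorem exists_minimizer : ∃ y ∈ Q.polytope, (∀ x ∈ Q.polytope, Q.F y ≤ Q.F x) ∧
    Q.optValue = Q.F y := by
  obtain ⟨y, hy, hmin⟩ := Q.isCompact_polytope.exists_isMinOn Q.polytope_nonempty
    Q.continuous_F.continuousOn
  refine ⟨y, hy, hmin, ?_⟩
  exact IsLeast.csInf_eq ⟨⟨y, hy, rfl⟩, by rintro _ ⟨x, hx, rfl⟩; exact hmin hx⟩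

end ASFW.Problem

namespace ASFW

variable {n p q : ℕ} (Q : Problem n p q)

namespace Problem

/-! ### The sampled objective and the progress of one step. -/

section Batch

variable {m : ℕ} (ξ : Fin m → Fin n)

theorem average_const (hm : 0 < m) (c : ℝ) : 1 / (m : ℝ) * ∑ _i : Fin m, c = c := by
  have : (m : ℝ) ≠ 0 := by positivity
  simp [this]

theorem inner_batchGrad (x δ : Vec p) :
    ⟪Q.batchGrad ξ x, δ⟫ = 1 / (m : ℝ) * ∑ i, ⟪gradient (Q.f (ξ i)) x, δ⟫ := by
  rw [batchGrad, real_inner_smul_left, sum_inner]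

theorem batchF_add_inner_add_le (hm : 0 < m) (x y : Vec p) :
    Q.batchF ξ x + ⟪Q.batchGrad ξ x, y - x⟫ + Q.sigmaF / 2 * ‖y - x‖ ^ 2 ≤ Q.batchF ξ y := by
  rw [inner_batchGrad, ← average_const hm (Q.sigmaF / 2 * ‖y - x‖ ^ 2), batchF, batchF, ← mul_add,
    ← mul_add, ← Finset.sum_add_distrib, ← Finset.sum_add_distrib]
  gcongr with i
  refine le_trans ?_ (StrongConvexOn.add_inner_gradient_add_le (Q.strongConvex (ξ i))
    (Q.differentiable (ξ i)) x y)
  gcongr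
  exact Q.sigmaF_le _

theorem batchF_le_of_ray (x δ : Vec p) {t : ℝ} (ht : 0 ≤ t) :
    Q.batchF ξ (x + t • δ) ≤
      Q.batchF ξ x + t * ⟪Q.batchGrad ξ x, δ⟫ + Q.batchL ξ * ‖δ‖ ^ 2 / 2 * t ^ 2 := by
  have e : Q.batchF ξ x + t * ⟪Q.batchGrad ξ x, δ⟫ + Q.batchL ξ * ‖δ‖ ^ 2 / 2 * t ^ 2 =
      1 / (m : ℝ) * ∑ i, (Q.f (ξ i) x + t * ⟪gradient (Q.f (ξ i)) x, δ⟫ +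
        Q.L (ξ i) * ‖δ‖ ^ 2 / 2 * t ^ 2) := by
    rw [Finset.sum_add_distrib, Finset.sum_add_distrib, ← Finset.mul_sum, ← Finset.sum_mul,
      ← Finset.sum_div, ← Finset.sum_mul, inner_batchGrad, batchF, batchL]
    ring
  rw [e, batchF]
  gcongr with i
  exact le_of_lipschitzWith_gradient (Q.differentiable _) (Q.lipschitz_gradient _) x δ ht

/-- Needed for exact line search, where a local minimum along a ray has to be a global one. -/
theorem convexOn_batchF_ray (x δ : Vec p) :
    ConvexOn ℝ (Set.Ici 0) fun t : ℝ => Q.batchF ξ (x + t • δ) := by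
  refine ⟨convex_Ici 0, fun s _ t _ a b ha hb hab => ?_⟩
  have hc : ∀ i, Q.f (ξ i) (a • (x + s • δ) + b • (x + t • δ)) ≤
      a * Q.f (ξ i) (x + s • δ) + b * Q.f (ξ i) (x + t • δ) := fun i =>
    ((Q.strongConvex (ξ i)).strictConvexOn (Q.σ_pos _)).convexOn.2 (Set.mem_univ _)
      (Set.mem_univ _) ha hb hab
  have e : x + (a • s + b • t) • δ = a • (x + s • δ) + b • (x + t • δ) := by
    calc _ = (a + b) • x + (a • s + b • t) • δ := by rw [hab, one_smul]
      _ = _ := by simp only [smul_eq_mul]; module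
  simp only [batchF, smul_eq_mul] at *
  rw [e, mul_left_comm a, mul_left_comm b, ← mul_add, Finset.mul_sum _ _ a, Finset.mul_sum _ _ b,
    ← Finset.sum_add_distrib]
  gcongr with i
  exact hc i

theorem batchL_nonneg : 0 ≤ Q.batchL ξ := by
  unfold batchL
  positivity

theorem batchL_pos (hm : 0 < m) {x y : Vec p} (hxy : x ≠ y) : 0 < Q.batchL ξ := by
  have : Nonempty (Fin m) := ⟨⟨0, hm⟩⟩
  unfold batchL
  have := Finset.sum_pos (fun i _ => Q.L_pos hxy (ξ i)) (Finset.univ_nonempty (α := Fin m))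
  positivity

theorem batchL_le (hm : 0 < m) : Q.batchL ξ ≤ Q.LF := by
  rw [← average_const hm Q.LF, batchL]
  gcongr with i
  exact Q.L_le_LF _

/-- Progress of a step of admissible length in a descent direction. -/
theorem IsStepLength.progress (hm : 0 < m) {x δ : Vec p} {γmax γ : ℝ} (hmax : 0 ≤ γmax)
    (hδ : ⟪Q.batchGrad ξ x, δ⟫ ≤ 0) (hγ : Q.IsStepLength ξ x δ γmax γ) :
    0 ≤ γ ∧ γ ≤ γmax ∧ Q.batchF ξ (x + γ • δ) ≤ Q.batchF ξ x ∧
      (γ < γmax → ⟪Q.batchGrad ξ x, δ⟫ ^ 2 ≤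
        2 * (Q.batchL ξ * ‖δ‖ ^ 2) * (Q.batchF ξ x - Q.batchF ξ (x + γ • δ))) ∧
      (γmax = 1 → ⟪Q.batchGrad ξ x, δ⟫ ^ 2 ≤
        2 * (Q.batchL ξ * ‖δ‖ ^ 2) * (Q.batchF ξ x - Q.batchF ξ (x + γ • δ)) ∨
        -⟪Q.batchGrad ξ x, δ⟫ ≤ 2 * (Q.batchF ξ x - Q.batchF ξ (x + γ • δ))) := by
  have hray := fun t ht => Q.batchF_le_of_ray ξ x δ (t := t) ht
  have hconv := Q.convexOn_batchF_ray ξ x δ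
  set s := -⟪Q.batchGrad ξ x, δ⟫ with hs
  have hs' : ⟪Q.batchGrad ξ x, δ⟫ = -s := by rw [hs, neg_neg]
  rw [hs', neg_sq]
  have hs0 : 0 ≤ s := by linarith
  set ℓ := Q.batchL ξ * ‖δ‖ ^ 2 with hℓ
  have hℓ0 : 0 ≤ ℓ := mul_nonneg (Q.batchL_nonneg ξ) (sq_nonneg _)
  -- If `δ ≠ 0` the space has two distinct points, so the sampled Lipschitz constant is positive.
  -- The degenerate quotient is therefore always `0/0`.
  have hzero : ℓ = 0 → s = 0 := by
    intro h
    by_cases h0 : δ = 0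
    · rw [hs, h0, inner_zero_right, neg_zero]
    · have : 0 < Q.batchL ξ := Q.batchL_pos ξ hm h0
      have := norm_pos_iff.2 h0
      have : 0 < ℓ := by positivity
      exact absurd h this.ne'
  -- The unconstrained minimizer of the quadratic model along the ray.
  set a := s / ℓ with ha
  have haℓ : ℓ * a = s := by
    by_cases h : ℓ = 0
    · rw [h, hzero h, zero_mul]
    · rw [ha, mul_div_cancel₀ _ h]
  have ha0 : 0 ≤ a := div_nonneg hs0 hℓ0
  simp only [hs'] at hray
  have hshort : ∀ t, 0 ≤ t → t ≤ a → Q.batchF ξ (x + t • δ) ≤ Q.batchF ξ x - t * s / 2 := by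
    intro t ht hta
    have h1 := hray t ht
    have h2 : t * (ℓ * t) ≤ t * s :=
      mul_le_mul_of_nonneg_left (haℓ ▸ mul_le_mul_of_nonneg_left hta hℓ0) ht
    nlinarith
  have hA : ∀ z, z ≤ Q.batchF ξ (x + a • δ) → s ^ 2 ≤ 2 * ℓ * (Q.batchF ξ x - z) := by
    intro z hz
    have h1 := hshort a ha0 le_rfl
    have h2 : ℓ * (a * s / 2) ≤ ℓ * (Q.batchF ξ x - z) :=
      mul_le_mul_of_nonneg_left (by linarith) hℓ0
    have h3 : ℓ * (a * s / 2) = s ^ 2 / 2 := by rw [← haℓ]; ring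
    linarith
  have hmin0 : 0 ≤ min a γmax := le_min ha0 hmax
  have hminF := hshort _ hmin0 (min_le_left a γmax)
  have hmins : 0 ≤ min a γmax * s / 2 := by positivity
  rcases hγ with h | ⟨hmem, hmin⟩
  · change γ = min a γmax at h
    rw [h]
    refine ⟨hmin0, min_le_right _ _, by linarith, fun hlt => ?_, fun h1 => ?_⟩
    · rcases min_lt_iff.1 hlt with h | h
      · exact hA _ (by rw [min_eq_left h.le])
      · exact absurd h (lt_irrefl _)
    · rcases le_total a γmax with h | h
      · left
        exact hA _ (by rw [min_eq_left h])
      · right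
        rw [min_eq_right h, h1] at hminF ⊢
        linarith
  · have hle : ∀ t, 0 ≤ t → t ≤ γmax → Q.batchF ξ (x + γ • δ) ≤ Q.batchF ξ (x + t • δ) :=
      fun t h0 h1 => hmin (Set.mem_Icc.2 ⟨h0, h1⟩)
    refine ⟨hmem.1, hmem.2, ?_, fun hlt => ?_, fun h1 => ?_⟩
    · simpa using hle 0 le_rfl hmax
    · apply hA
      -- A line-search minimizer below `γmax` is a local minimizer on the whole ray, hence by
      -- convexity a global one. It beats the step `a` even when `a` exceeds `γmax`.
      have hloc : IsLocalMinOn (fun t : ℝ => Q.batchF ξ (x + t • δ)) (Set.Ici 0) γ := by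
        have : Set.Iio γmax ∈ 𝓝[Set.Ici 0] γ := mem_nhdsWithin_of_mem_nhds (Iio_mem_nhds hlt)
        filter_upwards [this, self_mem_nhdsWithin] with t ht ht0
        exact hle t ht0 (le_of_lt ht)
      exact IsMinOn.of_isLocalMinOn_of_convexOn (Set.mem_Ici.2 hmem.1) hloc hconv
        (Set.mem_Ici.2 ha0)
    · rcases le_total a γmax with h | h
      · exact Or.inl (hA _ (hle a ha0 h))
      · right
        -- Here `a ≥ 1`, so the full step is a competitor and already decreases the model by `s /
        -- 2`.
        have h2 := hle 1 zero_le_one h1.ge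
        have h3 := hshort 1 zero_le_one (h1 ▸ h)
        linarith

end Batch

end Problem

/-! ### Invariance of the convex representation under the updates. -/

/-- The weights of a state represent its iterate as a convex combination of vertices in `U`. -/
structure State.Valid (S : State p) : Prop where
  subset : ∀ v ∈ S.U, v ∈ Q.vertices
  nonneg : ∀ v, 0 ≤ S.μ v
  support : ∀ v, v ∉ S.U → S.μ v = 0
  sum_one : ∑ v ∈ S.U, S.μ v = 1
  repr : ∑ v ∈ S.U, S.μ v • v = S.x

namespace State.Valid

variable {Q} {S T : State p}

theorem initial {x₁ : Vec p} (h : x₁ ∈ Q.vertices) : (State.initial x₁).Valid Q := by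
  constructor
  · intro v hv
    rw [Finset.mem_singleton.1 hv]
    exact h
  · intro v
    simp only [State.initial]
    split_ifs <;> norm_num
  · intro v hv
    exact if_neg fun h => hv (Finset.mem_singleton.2 h)
  · simp [State.initial]
  · simp [State.initial]

theorem mem_polytope (h : S.Valid Q) : S.x ∈ Q.polytope := by
  rw [← h.repr]
  exact Q.convex_polytope.sum_mem (fun v _ => h.nonneg v) h.sum_one
    fun v hv => Q.vertices_subset (h.subset v hv)

/-- Lets both updates be checked on an index set that is too large, with the weightless vertices
discarded afterwards. -/
theorem shrink (h : S.Valid Q) {U : Finset (Vec p)} (hU : U ⊆ S.U) (h0 : ∀ v ∉ U, S.μ v = 0) :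
    (State.mk S.x U S.μ).Valid Q where
  subset v hv := h.subset v (hU hv)
  nonneg := h.nonneg
  support v hv := h0 v hv
  sum_one := by
    rw [← h.sum_one]
    exact Finset.sum_subset hU fun v _ hv => h0 v hv
  repr := by
    refine Eq.trans ?_ h.repr
    exact Finset.sum_subset hU fun v _ hv => by simp only; rw [h0 v hv, zero_smul]

theorem weight_le_one (h : S.Valid Q) {u : Vec p} (hu : u ∈ S.U) : S.μ u ≤ 1 := by
  rw [← h.sum_one]
  exact Finset.single_le_sum (fun v _ => h.nonneg v) hu

theorem weight_eq_zero (h : S.Valid Q) {u v : Vec p} (hu : u ∈ S.U) (h1 : S.μ u = 1)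
    (hv : v ≠ u) : S.μ v = 0 := by
  classical
  by_cases hvU : v ∈ S.U
  · have h2 := h.sum_one
    rw [← Finset.add_sum_erase _ _ hu, h1, add_eq_left,
      Finset.sum_eq_zero_iff_of_nonneg fun v _ => h.nonneg v] at h2
    exact h2 v (Finset.mem_erase.2 ⟨hv, hvU⟩)
  · exact h.support v hvU

theorem eq_of_weight_eq_one (h : S.Valid Q) {u : Vec p} (hu : u ∈ S.U) (h1 : S.μ u = 1) :
    S.x = u := by
  rw [← h.repr, Finset.sum_eq_single_of_mem u hu, h1, one_smul]
  intro v _ hv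
  rw [h.weight_eq_zero hu h1 hv, zero_smul]

theorem nonempty (h : S.Valid Q) : S.U.Nonempty := by
  rw [Finset.nonempty_iff_ne_empty]
  intro h0
  have := h.sum_one
  rw [h0] at this
  simp at this

open Classical in
theorem away (h : S.Valid Q) {u : Vec p} (hu : u ∈ S.U) (hu1 : S.μ u < 1) {γ : ℝ} (h0 : 0 ≤ γ)
    (hγ : γ ≤ S.μ u / (1 - S.μ u)) : (S.away u γ).Valid Q := by
  have hγ' : γ * (1 - S.μ u) ≤ S.μ u := (le_div_iff₀ (by linarith)).1 hγ
  have hμ : ∀ v, (S.away u γ).μ v = (1 + γ) * S.μ v - if v = u then γ else 0 := by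
    intro v
    simp only [State.away]
    split_ifs with hv
    · rw [hv]; ring
    · ring
  have hfull : (State.mk (S.away u γ).x S.U (S.away u γ).μ).Valid Q := by
    refine ⟨h.subset, fun v => ?_, fun v hv => ?_, ?_, ?_⟩
    · rw [hμ]
      split_ifs with hv
      · rw [hv]; linarith
      · rw [sub_zero]; exact mul_nonneg (by linarith) (h.nonneg v)
    · rw [hμ, h.support v hv, if_neg (ne_of_mem_of_not_mem hu hv).symm]
      ring
    · simp only [hμ, Finset.sum_sub_distrib, ← Finset.mul_sum, h.sum_one, Finset.sum_ite_eq',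
        if_pos hu]
      ring
    · simp only [hμ, sub_smul, mul_smul, Finset.sum_sub_distrib, ← Finset.smul_sum, h.repr,
        ite_smul, zero_smul, Finset.sum_ite_eq', if_pos hu]
      simp only [State.away]
      module
  by_cases hz : S.μ u * (1 + γ) - γ = 0
  · have hU : (S.away u γ).U = S.U.erase u := if_pos hz
    have := hfull.shrink (U := (S.away u γ).U) (by rw [hU]; exact Finset.erase_subset _ _) (by
      intro v hv
      rw [hU, Finset.mem_erase, not_and] at hv
      by_cases hvu : v = u
      · rw [hvu]
        simpa [State.away] using hz
      · exact hfull.support v (hv hvu))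
    exact this
  · have hU : (S.away u γ).U = S.U := if_neg hz
    rw [← hU] at hfull
    exact hfull

open Classical in
theorem forward (h : S.Valid Q) {w : Vec p} (hw : w ∈ Q.vertices) {γ : ℝ} (h0 : 0 ≤ γ)
    (h1 : γ ≤ 1) : (S.forward w γ).Valid Q := by
  have hμ : ∀ v, (S.forward w γ).μ v = (1 - γ) * S.μ v + if v = w then γ else 0 := by
    intro v
    simp only [State.forward]
    split_ifs with hv
    · rw [hv]; ring
    · ring
  have hs : ∀ v ∈ insert w S.U, v ∉ S.U → S.μ v = 0 := fun v _ hv => h.support v hv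
  have hsum : ∑ v ∈ insert w S.U, S.μ v = 1 := by
    rw [← h.sum_one]
    exact (Finset.sum_subset (Finset.subset_insert _ _) hs).symm
  have hrepr : ∑ v ∈ insert w S.U, S.μ v • v = S.x := by
    rw [← h.repr]
    exact (Finset.sum_subset (Finset.subset_insert _ _)
      fun v hv hv' => by rw [hs v hv hv', zero_smul]).symm
  have hwU : w ∈ insert w S.U := Finset.mem_insert_self _ _
  have hfull : (State.mk (S.forward w γ).x (insert w S.U) (S.forward w γ).μ).Valid Q := by
    refine ⟨fun v hv => ?_, fun v => ?_, fun v hv => ?_, ?_, ?_⟩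
    · rcases Finset.mem_insert.1 hv with rfl | hv
      · exact hw
      · exact h.subset v hv
    · rw [hμ]
      have := mul_nonneg (sub_nonneg.2 h1) (h.nonneg v)
      split_ifs <;> linarith
    · rw [Finset.mem_insert, not_or] at hv
      rw [hμ, h.support v hv.2, if_neg hv.1]
      ring
    · simp only [hμ, Finset.sum_add_distrib, ← Finset.mul_sum, hsum, Finset.sum_ite_eq',
        if_pos hwU]
      ring
    · simp only [hμ, add_smul, mul_smul, Finset.sum_add_distrib, ← Finset.smul_sum, hrepr,
        ite_smul, zero_smul, Finset.sum_ite_eq', if_pos hwU]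
      simp only [State.forward]
      module
  by_cases hz : S.μ w * (1 - γ) + γ = 1
  · have hU : (S.forward w γ).U = {w} := if_pos hz
    refine hfull.shrink (U := (S.forward w γ).U) ?_ ?_
    · rw [hU]
      exact Finset.singleton_subset_iff.2 hwU
    · intro v hv
      rw [hU, Finset.mem_singleton] at hv
      refine hfull.weight_eq_zero hwU ?_ hv
      simpa [State.forward] using hz
  · have hU : (S.forward w γ).U = insert w S.U := if_neg hz
    rw [← hU] at hfull
    exact hfull

open Classical in
theorem card_forward_le (S : State p) (w : Vec p) (γ : ℝ) :
    (S.forward w γ).U.card ≤ S.U.card + 1 := by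
  simp only [State.forward]
  split_ifs
  · simp
  · exact Finset.card_insert_le _ _

open Classical in
theorem card_away_le (S : State p) (u : Vec p) (γ : ℝ) :
    (S.away u γ).U.card ≤ S.U.card := by
  simp only [State.away]
  split_ifs
  · exact Finset.card_le_card (Finset.erase_subset _ _)
  · exact le_rfl

theorem finish {car : Bool} (h : S.Valid Q) (hf : S.Finish car T) :
    T.Valid Q ∧ T.U.card ≤ S.U.card ∧ T.x = S.x := by
  unfold State.Finish at hf
  split_ifs at hf
  · exact ⟨⟨fun v hv => h.subset v (hf.subset hv), hf.nonneg, hf.support, hf.sum_one, hf.repr⟩,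
      Finset.card_le_card hf.subset, hf.same_x⟩
  · rw [hf]
    exact ⟨h, le_rfl, rfl⟩

theorem card_le (h : S.Valid Q) : S.U.card ≤ Q.vertices.ncard := by
  rw [← Set.ncard_coe_finset]
  exact Set.ncard_le_ncard (fun v hv => h.subset v hv) Q.finite_vertices

end State.Valid

/-! ### Error bound and contraction in one iteration. -/

namespace Problem

/-- Error bound: the suboptimality is dominated by the squared spread of the gradient between the
active vertices and all vertices. -/
theorem exists_gap_bound : ∃ K : ℝ, 0 ≤ K ∧ ∀ {m : ℕ} (ξ : Fin m → Fin n), 0 < m →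
    ∀ S : State p, S.Valid Q → ∀ y ∈ Q.polytope, ∀ α β : ℝ,
      (∀ v ∈ S.U, ⟪Q.batchGrad ξ S.x, v⟫ ≤ α) → (∀ v ∈ Q.vertices, β ≤ ⟪Q.batchGrad ξ S.x, v⟫) →
      2 * Q.sigmaF * (Q.batchF ξ S.x - Q.batchF ξ y) ≤ K ^ 2 * (α - β) ^ 2 := by
  classical
  obtain ⟨K, hK0, hK⟩ := exists_inner_sub_le Q.finite_vertices.toFinset
  refine ⟨K, hK0, fun ξ hm S hS y hy α β hα hβ => ?_⟩
  have hsub : S.U ⊆ Q.finite_vertices.toFinset := fun v hv => by simpa using hS.subset v hv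
  have hsum : ∑ v ∈ Q.finite_vertices.toFinset, S.μ v = 1 := by
    rw [← hS.sum_one]
    exact (Finset.sum_subset hsub fun v _ hv => hS.support v hv).symm
  have hrepr : ∑ v ∈ Q.finite_vertices.toFinset, S.μ v • v = S.x := by
    rw [← hS.repr]
    exact (Finset.sum_subset hsub fun v _ hv => by rw [hS.support v hv, zero_smul]).symm
  obtain ⟨ν, hν0, hν1, hν⟩ : ∃ ν : Vec p → ℝ, (∀ v ∈ Q.finite_vertices.toFinset, 0 ≤ ν v) ∧
      ∑ v ∈ Q.finite_vertices.toFinset, ν v = 1 ∧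
      ∑ v ∈ Q.finite_vertices.toFinset, ν v • v = y := by
    rw [← Finset.mem_convexHull', Set.Finite.coe_toFinset, Q.convexHull_vertices]
    exact hy
  have h1 := hK S.μ ν (fun v _ => hS.nonneg v) hν0 hsum hν1 (Q.batchGrad ξ S.x) α β
    (fun v _ hv => hα v (by_contra fun h => hv (hS.support v h)))
    (fun v hv => hβ v (by simpa using hv))
  rw [hrepr, hν] at h1
  have h2 := Q.batchF_add_inner_add_le ξ hm S.x y
  rw [norm_sub_rev, ← neg_sub S.x y, inner_neg_right] at h2
  have hσ := Q.sigmaF_pos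
  set r := ‖S.x - y‖
  have h3 : Q.batchF ξ S.x - Q.batchF ξ y ≤ K * r * (α - β) - Q.sigmaF / 2 * r ^ 2 := by linarith
  have h4 := mul_le_mul_of_nonneg_left h3 (show 0 ≤ 2 * Q.sigmaF by positivity)
  -- Completing the square removes the unknown distance `r`.
  nlinarith [sq_nonneg (K * (α - β) - Q.sigmaF * r)]

/-- Every iteration either decreases the sampled suboptimality by a fixed factor, or removes an
active vertex without increasing the sampled objective. -/
theorem exists_contraction : ∃ κ : ℝ, 0 < κ ∧ κ < 1 ∧ ∀ (car : Bool) {m : ℕ} (ξ : Fin m → Fin n),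
    0 < m → ∀ S T : State p, S.Valid Q → Q.Step car ξ S T → T.Valid Q ∧
      ((T.U.card ≤ S.U.card + 1 ∧ ∀ y ∈ Q.polytope,
          Q.batchF ξ T.x - Q.batchF ξ y ≤ (1 - κ) * (Q.batchF ξ S.x - Q.batchF ξ y)) ∨
        (T.U.card + 1 ≤ S.U.card ∧ Q.batchF ξ T.x ≤ Q.batchF ξ S.x)) := by
  classical
  obtain ⟨K, hK0, hK⟩ := Q.exists_gap_bound
  have hσ := Q.sigmaF_pos
  have hLF : 0 ≤ Q.LF := NNReal.zero_le_coe.trans (Q.L_le_LF ⟨0, Q.n_pos⟩)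
  set M := 4 * K ^ 2 * (Q.LF * Q.D ^ 2) with hM
  have hM0 : 0 ≤ M := by positivity
  -- In the denominator, `M` pays for steps with quadratic progress and `2 * sigmaF` for full
  -- Frank–Wolfe steps, so one factor serves both.
  refine ⟨Q.sigmaF / (M + 2 * Q.sigmaF), by positivity, ?_, fun car m ξ hm S T hS hstep => ?_⟩
  · rw [div_lt_one (by positivity)]
    linarith
  obtain ⟨w, hw, u, hu, hwmin, humax, hcase⟩ := hstep
  set g := Q.batchGrad ξ S.x with hg
  have hxP := hS.mem_polytope
  have hwP := Q.vertices_subset hw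
  have huP := Q.vertices_subset (hS.subset u hu)
  -- Applied with `s = -⟪g, δ⟫`: the spread is the sum of the Frank–Wolfe and away slopes, and the
  -- algorithm follows the larger of the two.
  have hgap : ∀ y ∈ Q.polytope, ∀ s : ℝ, ⟪g, u⟫ - ⟪g, w⟫ ≤ 2 * s →
      Q.sigmaF * (Q.batchF ξ S.x - Q.batchF ξ y) ≤ 2 * K ^ 2 * s ^ 2 := by
    intro y hy s hs
    have h1 := hK ξ hm S hS y hy _ _ humax fun v hv => hwmin v (Q.vertices_subset hv)
    have h0 := hwmin u huP
    have h2 : (⟪g, u⟫ - ⟪g, w⟫) ^ 2 ≤ (2 * s) ^ 2 := pow_le_pow_left₀ (by linarith) hs 2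
    have h3 := mul_le_mul_of_nonneg_left h2 (sq_nonneg K)
    linarith
  have hfin : ∀ y z : ℝ,
      Q.sigmaF * (Q.batchF ξ S.x - y) ≤ (M + 2 * Q.sigmaF) * (Q.batchF ξ S.x - z) →
      z - y ≤ (1 - Q.sigmaF / (M + 2 * Q.sigmaF)) * (Q.batchF ξ S.x - y) := by
    intro y z h
    have : Q.sigmaF / (M + 2 * Q.sigmaF) * (Q.batchF ξ S.x - y) ≤ Q.batchF ξ S.x - z := by
      rw [div_mul_eq_mul_div, div_le_iff₀ (by positivity)]
      linarith
    linarith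
  have hgood : ∀ δ : Vec p, ‖δ‖ ≤ Q.D → ∀ z : ℝ, z ≤ Q.batchF ξ S.x →
      ⟪g, u⟫ - ⟪g, w⟫ ≤ 2 * -⟪g, δ⟫ →
      ⟪g, δ⟫ ^ 2 ≤ 2 * (Q.batchL ξ * ‖δ‖ ^ 2) * (Q.batchF ξ S.x - z) →
      ∀ y ∈ Q.polytope, z - Q.batchF ξ y ≤
        (1 - Q.sigmaF / (M + 2 * Q.sigmaF)) * (Q.batchF ξ S.x - Q.batchF ξ y) := by
    intro δ hδ z hz hs hprog y hy
    apply hfin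
    have h1 := hgap y hy _ hs
    rw [neg_sq] at h1
    have h2 : Q.batchL ξ * ‖δ‖ ^ 2 ≤ Q.LF * Q.D ^ 2 := by
      gcongr
      exact Q.batchL_le ξ hm
    have h3 := mul_le_mul_of_nonneg_right h2 (sub_nonneg.2 hz)
    have h4 := mul_le_mul_of_nonneg_left hprog (show 0 ≤ 2 * K ^ 2 by positivity)
    have h5 := mul_le_mul_of_nonneg_left h3 (show 0 ≤ 4 * K ^ 2 by positivity)
    have h6 := mul_nonneg hσ.le (sub_nonneg.2 hz)
    rw [hM]
    nlinarith
  have hwx : ⟪g, w⟫ ≤ ⟪g, S.x⟫ := hwmin _ hxP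
  rw [inner_sub_right, inner_add_right, real_inner_smul_right] at hcase
  rcases hcase with ⟨hfw, γ, hγ, hT⟩ | ⟨haw, γ, hγ, hT⟩
  · have hgδ : ⟪g, w - S.x⟫ ≤ 0 := by rw [inner_sub_right]; linarith
    obtain ⟨h0, h1, hdec, -, hprog⟩ := hγ.progress Q ξ hm zero_le_one hgδ
    obtain ⟨hTV, hTc, hTx⟩ := (hS.forward hw h0 h1).finish hT
    refine ⟨hTV, Or.inl ⟨hTc.trans (State.Valid.card_forward_le S w γ), ?_⟩⟩
    rw [hTx]
    change ∀ y ∈ Q.polytope, Q.batchF ξ (S.x + γ • (w - S.x)) - Q.batchF ξ y ≤ _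
    rcases hprog rfl with h | h
    · refine hgood _ (Q.norm_sub_le_D hwP hxP) _ hdec ?_ h
      rw [inner_sub_right]
      linarith
    -- The step is long: its decrease is at least half the Frank–Wolfe slope, which by convexity
    -- dominates the suboptimality itself.
    · intro y hy
      apply hfin
      have h2 := Q.batchF_add_inner_add_le ξ hm S.x y
      have h3 : ⟪g, w - S.x⟫ ≤ ⟪g, y - S.x⟫ := by
        rw [inner_sub_right, inner_sub_right]
        linarith [hwmin y hy]
      have h4 : 0 ≤ Q.sigmaF / 2 * ‖y - S.x‖ ^ 2 := by positivity
      have h5 : Q.batchF ξ S.x - Q.batchF ξ y ≤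
          2 * (Q.batchF ξ S.x - Q.batchF ξ (S.x + γ • (w - S.x))) := by linarith
      have h6 := mul_le_mul_of_nonneg_left h5 hσ.le
      have h7 := mul_nonneg hM0 (sub_nonneg.2 hdec)
      linarith
  · have hgδ : ⟪g, S.x - u⟫ < 0 := by rw [inner_sub_right]; linarith
    -- Weight `1` would make the away direction zero, against strict descent; thus `γmax` has a
    -- nonzero denominator.
    have hu1 : S.μ u < 1 := by
      refine lt_of_le_of_ne (hS.weight_le_one hu) fun h => ?_
      rw [hS.eq_of_weight_eq_one hu h, sub_self, inner_zero_right] at hgδ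
      exact lt_irrefl _ hgδ
    have hmax : 0 ≤ S.μ u / (1 - S.μ u) := div_nonneg (hS.nonneg u) (by linarith)
    obtain ⟨h0, h1, hdec, hprog, -⟩ := hγ.progress Q ξ hm hmax hgδ.le
    obtain ⟨hTV, hTc, hTx⟩ := (hS.away hu hu1 h0 h1).finish hT
    refine ⟨hTV, ?_⟩
    rw [hTx]
    change (_ ∧ ∀ y ∈ Q.polytope, Q.batchF ξ (S.x + γ • (S.x - u)) - Q.batchF ξ y ≤ _) ∨
      (_ ∧ Q.batchF ξ (S.x + γ • (S.x - u)) ≤ _)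
    -- Below the maximal length the quadratic progress is available; at the maximal length the
    -- weight of `u` becomes exactly zero.
    rcases h1.lt_or_eq with hlt | heq
    · left
      refine ⟨hTc.trans ((State.Valid.card_away_le S u γ).trans (Nat.le_succ _)),
        hgood _ (Q.norm_sub_le_D hxP huP) _ hdec ?_ (hprog hlt)⟩
      rw [inner_sub_right]
      linarith
    · right
      refine ⟨?_, hdec⟩
      have hz : S.μ u * (1 + γ) - γ = 0 := by
        have : 1 - S.μ u ≠ 0 := by linarith
        rw [heq]
        field_simp
        ring
      have hU : (S.away u γ).U = S.U.erase u := if_pos hz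
      rw [hU, Finset.card_erase_of_mem hu] at hTc
      have := Finset.card_pos.2 hS.nonempty
      lia

end Problem

end ASFW

/-! ### From mean to almost sure convergence, and sampling errors. -/

namespace ASFW

/-- Convergence in mean at a linear rate implies almost sure convergence at any slower rate. -/
theorem ae_tendsto_div_pow {Ω : Type*} [MeasurableSpace Ω] (P : Measure Ω) (Y : ℕ → Ω → ℝ)
    [IsProbabilityMeasure P] {l C r s : ℝ} (hr : 0 < r) (hrs : r < s)
    (h : ∀ k : ℕ, 1 ≤ k → Integrable (Y k) P ∧ ∫ a, |Y k a - l| ∂P ≤ C * r ^ k) :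
    ∀ᵐ a ∂P, Tendsto (fun k : ℕ => (Y k a - l) / s ^ k) atTop (𝓝 0) := by
  have hs : 0 < s := hr.trans hrs
  set Z : ℕ → Ω → ℝ := fun k a => |Y (k + 1) a - l| / s ^ (k + 1) with hZ
  have hZ0 : ∀ k a, 0 ≤ Z k a := fun k a => by positivity
  have hint : ∀ k, Integrable (Z k) P := fun k =>
    (((h (k + 1) (Nat.le_add_left 1 k)).1.sub (integrable_const l)).abs).div_const _
  have hq0 : 0 ≤ r / s := by positivity
  have hq1 : r / s < 1 := (div_lt_one hs).2 hrs
  have hle : ∀ k, ∫ a, Z k a ∂P ≤ C * (r / s) ^ (k + 1) := by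
    intro k
    rw [hZ, integral_div, div_pow, ← mul_div_assoc]
    gcongr
    exact (h (k + 1) (Nat.le_add_left 1 k)).2
  have hsum : Summable fun k => C * (r / s) ^ (k + 1) :=
    (((summable_nat_add_iff 1).2 (summable_geometric_of_lt_one hq0 hq1))).mul_left C
  -- By Tonelli the expected sum is dominated by a geometric series, so the sum is almost surely
  -- finite.
  have hfin : ∫⁻ a, ∑' k, ENNReal.ofReal (Z k a) ∂P ≠ ⊤ := by
    rw [lintegral_tsum fun k => (hint k).aemeasurable.ennreal_ofReal]
    refine ne_top_of_le_ne_top hsum.tsum_ofReal_ne_top (ENNReal.tsum_le_tsum fun k => ?_)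
    rw [← ofReal_integral_eq_lintegral_ofReal (hint k) (ae_of_all _ (hZ0 k))]
    exact ENNReal.ofReal_le_ofReal (hle k)
  have hae := ae_lt_top' (AEMeasurable.tsum
    fun k => (hint k).aemeasurable.ennreal_ofReal) hfin
  filter_upwards [hae] with a ha
  have h1 := (ENNReal.tendsto_toReal ENNReal.zero_ne_top).comp
    (ENNReal.tendsto_atTop_zero_of_tsum_ne_top ha.ne)
  rw [ENNReal.toReal_zero] at h1
  have h2 : Tendsto (fun k => Z k a) atTop (𝓝 0) :=
    h1.congr fun k => ENNReal.toReal_ofReal (hZ0 k a)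
  rw [← tendsto_add_atTop_iff_nat 1, tendsto_zero_iff_abs_tendsto_zero]
  refine h2.congr fun k => ?_
  simp only [Function.comp, hZ, abs_div, abs_pow, abs_of_pos hs]

theorem convergesLinearly_of_tendsto {y : ℕ → ℝ} {l s : ℝ} (hs : 0 < s) (hs1 : s < 1)
    (h : Tendsto (fun k : ℕ => (y k - l) / s ^ k) atTop (𝓝 0)) : ConvergesLinearly y l := by
  obtain ⟨C, hC⟩ := h.abs.bddAbove_range
  refine ⟨s, hs, hs1, C, fun k _ => ?_⟩
  have : |(y k - l) / s ^ k| ≤ C := hC ⟨k, rfl⟩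
  rwa [abs_div, abs_of_pos (pow_pos hs k), div_le_iff₀ (pow_pos hs k)] at this

/-- The total deviation of the empirical frequencies of a sample from the uniform distribution. -/
noncomputable def deviation {n m : ℕ} (ξ : Fin m → Fin n) : ℝ :=
  ∑ j, |1 / (m : ℝ) * (∑ i, if ξ i = j then 1 else 0) - 1 / (n : ℝ)|

theorem deviation_nonneg {n m : ℕ} (ξ : Fin m → Fin n) : 0 ≤ deviation ξ :=
  Finset.sum_nonneg fun _ _ => abs_nonneg _

/-- The empirical frequencies of an independent uniform sample of size `m` deviate from uniformity
by `O(1 / √m)` in expectation. -/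
theorem integral_deviation_le {Ω : Type*} [MeasurableSpace Ω] (P : Measure Ω)
    [IsProbabilityMeasure P] {n m : ℕ} (hm : 0 < m) (ξ : Fin m → Ω → Fin n)
    (hmeas : ∀ i, Measurable (ξ i)) (hunif : ∀ i j, P {a | ξ i a = j} = (n : ℝ≥0∞)⁻¹)
    (hind : iIndepFun ξ P) :
    Integrable (fun a => deviation fun i => ξ i a) P ∧
      ∫ a, deviation (fun i => ξ i a) ∂P ≤ n * √(1 / m) := by
  have hm' : (0 : ℝ) < m := by exact_mod_cast hm
  set B : Fin n → Fin m → Ω → ℝ := fun j i a => if ξ i a = j then 1 else 0 with hB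
  have hBm : ∀ j i, Measurable (B j i) := fun j i =>
    Measurable.ite (hmeas i (measurableSet_singleton j)) measurable_const measurable_const
  have hB1 : ∀ j i a, |B j i a| ≤ 1 := by
    intro j i a
    simp only [hB]
    split_ifs <;> simp
  have hBL : ∀ j i, MemLp (B j i) 2 P := fun j i =>
    MemLp.of_bound (hBm j i).aestronglyMeasurable 1 (ae_of_all _ fun a => hB1 j i a)
  have hBE : ∀ j i, ∫ a, B j i a ∂P = 1 / n := by
    intro j i
    have : B j i = Set.indicator {a | ξ i a = j} fun _ => (1 : ℝ) := by
      ext a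
      simp [hB, Set.indicator_apply]
    have hmeasSet : MeasurableSet {a | ξ i a = j} := hmeas i (measurableSet_singleton j)
    rw [this, integral_indicator_const _ hmeasSet, measureReal_def, hunif]
    simp
  set X : Fin n → Ω → ℝ := fun j a => 1 / (m : ℝ) * (∑ i, B j i a) with hX
  have hsumL : ∀ j, MemLp (fun a => ∑ i, B j i a) 2 P := fun j =>
    memLp_finsetSum _ fun i _ => hBL j i
  have hXL : ∀ j, MemLp (X j) 2 P := fun j => (hsumL j).const_mul _
  have hXE : ∀ j, ∫ a, X j a ∂P = 1 / n := by
    intro j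
    simp only [hX]
    rw [integral_const_mul, integral_finsetSum _ fun i _ => (hBL j i).integrable one_le_two]
    simp only [hBE]
    simp [hm'.ne']
  have hXV : ∀ j, variance (X j) P ≤ 1 / m := by
    intro j
    have h1 : variance (∑ i, B j i) P = ∑ i, variance (B j i) P := by
      -- Independence enters here: the variances of the indicators add up, and division by `m ^ 2`
      -- leaves `1 / m`.
      refine IndepFun.variance_sum (fun i _ => hBL j i) fun i _ i' _ hne => ?_
      exact (hind.indepFun hne).comp (φ := fun z : Fin n => if z = j then (1 : ℝ) else 0)
        (ψ := fun z : Fin n => if z = j then (1 : ℝ) else 0)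
        (measurable_of_finite _) (measurable_of_finite _)
    have h2 : ∀ i, variance (B j i) P ≤ 1 := by
      intro i
      refine (variance_le_expectation_sq (hBm j i).aestronglyMeasurable).trans ?_
      calc _ ≤ ∫ _a, (1 : ℝ) ∂P := by
            refine integral_mono ((hBL j i).integrable_sq) (integrable_const _) fun a => ?_
            simpa using (sq_le_one_iff_abs_le_one _).2 (hB1 j i a)
        _ = 1 := by simp
    have h3 : (fun a => ∑ i, B j i a) = ∑ i, B j i := by
      ext a
      simp
    simp only [hX]
    rw [variance_const_mul, h3, h1]
    calc (1 / (m : ℝ)) ^ 2 * ∑ i, variance (B j i) P ≤ (1 / (m : ℝ)) ^ 2 * ∑ _i : Fin m, (1 : ℝ) := by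
          gcongr with i
          exact h2 i
      _ = 1 / (m : ℝ) := by
          simp
          field_simp
  have hYL : ∀ j, MemLp (fun a => |X j a - 1 / n|) 2 P := fun j =>
    ((hXL j).sub (memLp_const _)).abs
  have hYE : ∀ j, ∫ a, |X j a - 1 / n| ∂P ≤ √(1 / m) := by
    intro j
    apply Real.le_sqrt_of_sq_le
    -- Nonnegativity of the variance of the absolute deviation bounds its squared mean by the
    -- variance of `X j`.
    have h1 := variance_nonneg (fun a => |X j a - 1 / n|) P
    rw [variance_eq_sub (hYL j)] at h1
    have h2 : variance (X j) P = ∫ a, (X j a - 1 / n) ^ 2 ∂P := by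
      rw [variance_eq_integral (hXL j).aestronglyMeasurable.aemeasurable, hXE]
    have h3 : ∫ a, ((fun a => |X j a - 1 / n|) ^ 2) a ∂P = variance (X j) P := by
      rw [h2]
      simp
    rw [h3] at h1
    linarith [hXV j]
  have hYI : ∀ j, Integrable (fun a => |X j a - 1 / n|) P := fun j =>
    (hYL j).integrable one_le_two
  refine ⟨integrable_finsetSum _ fun j _ => hYI j, ?_⟩
  unfold deviation
  rw [integral_finsetSum _ fun j _ => hYI j]
  calc _ ≤ ∑ _j : Fin n, √(1 / (m : ℝ)) := Finset.sum_le_sum fun j _ => hYE j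
    _ = n * √(1 / m) := by simp

variable {n p q : ℕ} (Q : Problem n p q)

/-! ### Uniform sampling error on the polytope. -/

namespace Problem

theorem exists_f_bound : ∃ M : ℝ, 0 ≤ M ∧ ∀ x ∈ Q.polytope, ∀ i, |Q.f i x| ≤ M := by
  have h : ∀ i, ∃ M : ℝ, ∀ x ∈ Q.polytope, |Q.f i x| ≤ M := fun i =>
    Q.isCompact_polytope.exists_bound_of_continuousOn (Q.differentiable i).continuous.continuousOn
  choose M hM using h
  have hM0 : ∀ i, 0 ≤ M i := fun i => by
    obtain ⟨x, hx⟩ := Q.polytope_nonempty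
    exact (abs_nonneg _).trans (hM i x hx)
  exact ⟨∑ i, M i, Finset.sum_nonneg fun i _ => hM0 i, fun x hx i =>
    (hM i x hx).trans (Finset.single_le_sum (fun i _ => hM0 i) (Finset.mem_univ i))⟩

/-- Grouping the batch by index writes the error as a combination of the `f j` with frequency errors
as coefficients. The right side does not involve `x`, so the bound also applies to an iterate chosen
after seeing the batch. -/
theorem abs_batchF_sub_F_le {M : ℝ} (hM : ∀ x ∈ Q.polytope, ∀ i, |Q.f i x| ≤ M) {m : ℕ}
    (ξ : Fin m → Fin n) {x : Vec p} (hx : x ∈ Q.polytope) :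
    |Q.batchF ξ x - Q.F x| ≤ M * deviation ξ := by
  have e : Q.batchF ξ x - Q.F x =
      ∑ j, (1 / (m : ℝ) * (∑ i, if ξ i = j then 1 else 0) - 1 / (n : ℝ)) * Q.f j x := by
    simp only [sub_mul, Finset.sum_sub_distrib, mul_assoc, ← Finset.mul_sum, Finset.sum_mul]
    rw [Finset.sum_comm]
    simp [batchF, F]
  rw [e, deviation, Finset.mul_sum]
  refine (Finset.abs_sum_le_sum_abs _ _).trans (Finset.sum_le_sum fun j _ => ?_)
  rw [abs_mul, mul_comm]
  exact mul_le_mul_of_nonneg_right (hM x hx j) (abs_nonneg _)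

theorem batchSize_pos (car : Bool) (k : ℕ) : 0 < Q.batchSize car k := by
  have := Q.rho_le_half car
  have : 0 < 1 - Q.rho car := by linarith
  exact Nat.ceil_pos.2 (by positivity)

theorem sqrt_inv_batchSize_le (car : Bool) (k : ℕ) :
    √(1 / (Q.batchSize car k : ℝ)) ≤ (1 - Q.rho car) ^ (k + 1) := by
  have := Q.rho_le_half car
  have h0 : 0 < 1 - Q.rho car := by linarith
  apply Real.sqrt_le_iff.2 ⟨by positivity, ?_⟩
  rw [← pow_mul, one_div_le (by exact_mod_cast Q.batchSize_pos car k) (by positivity)]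
  have e : (k + 1) * 2 = 2 * k + 2 := by ring
  rw [e]
  exact Nat.le_ceil _

end Problem

/-! ### The potential argument and the expected rate. -/

/-- The solution of the recursion `ψ (k + 1) = b ψ k + A η (k + 1)`, `ψ 0 = A`. -/
noncomputable def majorant (b A : ℝ) (η : ℕ → ℝ) : ℕ → ℝ
  | 0 => A
  | k + 1 => b * majorant b A η k + A * η (k + 1)

/-- One iteration contracts the potential `a * B ^ c`, where `a` is the suboptimality, `c` the
number of active vertices, and `b = 1 / B`. -/
theorem potential_step {a a' η b B : ℝ} {c c' N : ℕ} (ha : 0 ≤ a) (hη : 0 ≤ η) (hb : 0 < b)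
    (hB : 1 ≤ B) (hbB : b * B = 1) (hc' : c' ≤ N)
    (h : (c' ≤ c + 1 ∧ a' ≤ b ^ 2 * a + η) ∨ (c' + 1 ≤ c ∧ a' ≤ a + η)) :
    a' * B ^ c' ≤ b * (a * B ^ c) + B ^ N * η := by
  have hB0 : 0 < B := by linarith
  have h1 : B ^ c' ≤ B ^ N := pow_le_pow_right₀ hB hc'
  have h2 : η * B ^ c' ≤ B ^ N * η := by
    rw [mul_comm]
    exact mul_le_mul_of_nonneg_right h1 hη
  rcases h with ⟨hc, h⟩ | ⟨hc, h⟩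
  · have h3 := mul_le_mul_of_nonneg_right h (pow_nonneg hB0.le c')
    have h4 : b ^ 2 * a * B ^ c' ≤ b ^ 2 * a * B ^ (c + 1) := by gcongr
    have h5 : b ^ 2 * a * B ^ (c + 1) = b * (a * B ^ c) * (b * B) := by ring
    rw [h5, hbB] at h4
    linarith
  · have h3 := mul_le_mul_of_nonneg_right h (pow_nonneg hB0.le c')
    have h4 : b * a * B ^ (c' + 1) ≤ b * a * B ^ c := by gcongr
    have h5 : b * a * B ^ (c' + 1) = a * B ^ c' * (b * B) := by ring
    rw [h5, hbB] at h4
    linarith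

namespace Problem

/-- Pathwise bound: the suboptimality is dominated by a contracting recursion driven by the
deviations of the samples. -/
theorem exists_majorant : ∃ b A : ℝ, 0 < b ∧ b < 1 ∧ 0 ≤ A ∧ ∀ (car : Bool)
    (ξ : (k : ℕ) → Fin (Q.batchSize car k) → Fin n) (S : ℕ → State p) (x₁ : Vec p),
    x₁ ∈ Q.vertices → S 1 = State.initial x₁ →
    (∀ k, 1 ≤ k → Q.Step car (ξ k) (S k) (S (k + 1))) → ∀ k, (S (k + 1)).Valid Q ∧
      Q.F (S (k + 1)).x - Q.optValue ≤ majorant b A (fun k => deviation (ξ k)) k := by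
  obtain ⟨κ, hκ0, hκ1, hκ⟩ := Q.exists_contraction
  obtain ⟨M, hM0, hM⟩ := Q.exists_f_bound
  obtain ⟨y, hy, hymin, hopt⟩ := Q.exists_minimizer
  obtain ⟨R, hR⟩ := Q.isCompact_polytope.exists_bound_of_continuousOn Q.continuous_F.continuousOn
  have hR0 : 0 ≤ R := (norm_nonneg _).trans (hR y hy)
  set b := √(1 - κ) with hb
  have hb0 : 0 < b := Real.sqrt_pos.2 (by linarith)
  have hb2 : b ^ 2 = 1 - κ := Real.sq_sqrt (by linarith)
  have hb1 : b < 1 := by nlinarith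
  set B := b⁻¹ with hB
  have hbB : b * B = 1 := mul_inv_cancel₀ hb0.ne'
  have hB1 : 1 ≤ B := (one_le_inv₀ hb0).2 hb1.le
  have hB0 : 0 < B := by linarith
  set N := Q.vertices.ncard
  -- One constant plays two roles: `2 * R * B` bounds the initial potential (gap at most `2 * R`,
  -- one active vertex), and `B ^ N * (4 * M)` is the noise coefficient.
  refine ⟨b, B ^ N * (4 * M) + 2 * R * B, hb0, hb1, by positivity, ?_⟩
  intro car ξ S x₁ hx₁ hS1 hstep
  have hnn : ∀ k, (S k).Valid Q → 0 ≤ Q.F (S k).x - Q.optValue := fun k hk => by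
    rw [hopt]
    exact sub_nonneg.2 (hymin _ hk.mem_polytope)
  have key : ∀ k, (S (k + 1)).Valid Q ∧
      (Q.F (S (k + 1)).x - Q.optValue) * B ^ (S (k + 1)).U.card ≤
        majorant b (B ^ N * (4 * M) + 2 * R * B) (fun k => deviation (ξ k)) k := by
    intro k
    induction k with
    | zero =>
      have hV : (S 1).Valid Q := by
        rw [hS1]
        exact State.Valid.initial hx₁
      refine ⟨hV, ?_⟩
      have hcard : (S 1).U.card = 1 := by
        rw [hS1]
        exact Finset.card_singleton _
      have h1 := abs_le.1 (hR _ hV.mem_polytope)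
      have h2 := abs_le.1 (hR _ hy)
      have h3 : Q.F (S 1).x - Q.optValue ≤ 2 * R := by linarith
      rw [zero_add, hcard, pow_one, majorant]
      have h4 := mul_le_mul_of_nonneg_right h3 hB0.le
      have h5 : 0 ≤ B ^ N * (4 * M) := by positivity
      linarith
    | succ k ih =>
      obtain ⟨hV, hle⟩ := ih
      obtain ⟨hV', hcase⟩ := hκ car (ξ (k + 1)) (Q.batchSize_pos car (k + 1)) _ _ hV
        (hstep (k + 1) (Nat.le_add_left 1 k))
      refine ⟨hV', ?_⟩
      set δ := deviation (ξ (k + 1)) with hδ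
      have hδ0 : 0 ≤ δ := deviation_nonneg _
      have hMδ : 0 ≤ M * δ := mul_nonneg hM0 hδ0
      have e1 := abs_le.1 (Q.abs_batchF_sub_F_le hM (ξ (k + 1)) hV.mem_polytope)
      have e2 := abs_le.1 (Q.abs_batchF_sub_F_le hM (ξ (k + 1)) hV'.mem_polytope)
      have e3 := abs_le.1 (Q.abs_batchF_sub_F_le hM (ξ (k + 1)) hy)
      -- Each passage between sampled and true gaps costs `2 * M * δ`. A contracting step makes two
      -- of them, hence the `4`.
      have hpot := potential_step (a := Q.F (S (k + 1)).x - Q.optValue)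
        (a' := Q.F (S (k + 1 + 1)).x - Q.optValue) (η := 4 * M * δ) (c := (S (k + 1)).U.card)
        (c' := (S (k + 1 + 1)).U.card) (N := N) (hnn _ hV) (by linarith) hb0 hB1 hbB
        hV'.card_le (by
          rcases hcase with ⟨hc, h⟩ | ⟨hc, h⟩
          · left
            refine ⟨hc, ?_⟩
            have h1 := h y hy
            rw [hb2, hopt]
            have h2 : (1 - κ) * (Q.batchF (ξ (k + 1)) (S (k + 1)).x - Q.batchF (ξ (k + 1)) y) ≤
                (1 - κ) * (Q.F (S (k + 1)).x - Q.F y + 2 * (M * δ)) :=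
              mul_le_mul_of_nonneg_left (by linarith) (by linarith)
            have h3 : 0 ≤ κ * (M * δ) := mul_nonneg hκ0.le hMδ
            linarith
          · right
            exact ⟨hc, by linarith⟩)
      rw [majorant]
      have h1 := mul_le_mul_of_nonneg_left hle hb0.le
      have h2 : 0 ≤ 2 * R * B * δ := by positivity
      linarith
  intro k
  obtain ⟨hV, hle⟩ := key k
  refine ⟨hV, le_trans ?_ hle⟩
  exact le_mul_of_one_le_right (hnn _ hV) (one_le_pow₀ hB1)

/-- Linear convergence in expectation, at a rate that depends only on the problem. -/
theorem exists_expected_rate (car : Bool) : ∃ r A : ℝ, 0 < r ∧ r < 1 ∧ 0 ≤ A ∧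
    ∀ (Ω : Type*) [MeasurableSpace Ω] (P : Measure Ω) [IsProbabilityMeasure P]
      (ξ : (k : ℕ) → Fin (Q.batchSize car k) → Ω → Fin n) (S : ℕ → Ω → State p),
      Q.IsASFW car P ξ S → ∀ k : ℕ, (∀ a, 0 ≤ Q.F (S (k + 1) a).x - Q.optValue) ∧
        Integrable (fun a => Q.F (S (k + 1) a).x) P ∧
        ∫ a, (Q.F (S (k + 1) a).x - Q.optValue) ∂P ≤ A * r ^ k := by
  obtain ⟨b, A, hb0, hb1, hA0, hmaj⟩ := Q.exists_majorant
  obtain ⟨y, hy, hymin, hopt⟩ := Q.exists_minimizer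
  obtain ⟨R, hR⟩ := Q.isCompact_polytope.exists_bound_of_continuousOn Q.continuous_F.continuousOn
  have hρ0 := Q.rho_pos car
  have hρ1 := Q.rho_le_half car
  -- Strictness above `b` avoids resonance between contraction and noise and makes the denominator
  -- `r - b` positive; `r > 1 - ρ` dominates the noise.
  obtain ⟨r, hr, hr1⟩ := exists_between (max_lt hb1 (by linarith : 1 - Q.rho car < 1))
  obtain ⟨hrb, hrρ⟩ := max_lt_iff.1 hr
  have hr0 : 0 < r := hb0.trans hrb
  have hrb' : 0 < r - b := sub_pos.2 hrb
  refine ⟨r, A + A * n / (r - b), hr0, hr1, by positivity, ?_⟩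
  intro Ω _ P _ ξ S hS
  obtain ⟨x₁, hx₁, hstart⟩ := hS.start
  have hpath := fun a => hmaj car (fun k i => ξ k i a) (fun k => S k a) x₁ hx₁ (hstart a)
    fun k hk => hS.step k hk a
  have hdev : ∀ k, 1 ≤ k → Integrable (fun a => deviation fun i => ξ k i a) P ∧
      ∫ a, deviation (fun i => ξ k i a) ∂P ≤ n * r ^ k := by
    intro k hk
    have hind : iIndepFun (ξ k) P := by
      refine hS.indep_sample.precomp (g := fun i => ⟨⟨k, i⟩, hk⟩) fun i j hij => ?_
      simpa using hij
    obtain ⟨h1, h2⟩ := integral_deviation_le P (Q.batchSize_pos car k) (ξ k)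
      (hS.measurable_sample k hk) (hS.uniform_sample k hk) hind
    refine ⟨h1, h2.trans ?_⟩
    gcongr
    refine (Q.sqrt_inv_batchSize_le car k).trans ?_
    calc (1 - Q.rho car) ^ (k + 1) ≤ (1 - Q.rho car) ^ k :=
          pow_le_pow_of_le_one (by linarith) (by linarith) (Nat.le_succ k)
      _ ≤ r ^ k := pow_le_pow_left₀ (by linarith) hrρ.le k
  have hmajI : ∀ k, Integrable
      (fun a => majorant b A (fun k => deviation fun i => ξ k i a) k) P ∧
      ∫ a, majorant b A (fun k => deviation fun i => ξ k i a) k ∂P ≤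
        (A + A * n / (r - b)) * r ^ k := by
    intro k
    induction k with
    | zero =>
      simp only [majorant]
      refine ⟨integrable_const _, ?_⟩
      have : 0 ≤ A * n / (r - b) := by positivity
      simpa using this
    | succ k ih =>
      obtain ⟨h1, h2⟩ := ih
      obtain ⟨h3, h4⟩ := hdev (k + 1) (Nat.le_add_left 1 k)
      simp only [majorant]
      refine ⟨(h1.const_mul b).add (h3.const_mul A), ?_⟩
      rw [integral_add (h1.const_mul b) (h3.const_mul A), integral_const_mul, integral_const_mul]
      have h5 := mul_le_mul_of_nonneg_left h2 hb0.le
      have h6 := mul_le_mul_of_nonneg_left h4 hA0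
      have h7 : A * n * r ^ (k + 1) ≤ A * n * r ^ k :=
        mul_le_mul_of_nonneg_left (pow_le_pow_of_le_one hr0.le hr1.le (Nat.le_succ k))
          (by positivity)
      have h8 : (A * n / (r - b)) * (r - b) = A * n := div_mul_cancel₀ _ hrb'.ne'
      have h9 : 0 ≤ A * (r - b) * r ^ k := by positivity
      -- The constant is chosen so that going from `b` to `r` leaves `A * n * r ^ k` to spare,
      -- exactly what the new noise needs.
      have h10 : (A + A * n / (r - b)) * r ^ (k + 1) =
          b * ((A + A * n / (r - b)) * r ^ k) + A * (r - b) * r ^ k +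
            (A * n / (r - b)) * (r - b) * r ^ k := by ring
      rw [h10, h8]
      linarith
  intro k
  have hI : Integrable (fun a => Q.F (S (k + 1) a).x) P :=
    Integrable.of_bound
      (Q.continuous_F.measurable.comp
        (hS.measurable_iterate (k + 1) (Nat.le_add_left 1 k))).aestronglyMeasurable R
      (ae_of_all _ fun a => hR _ (hpath a k).1.mem_polytope)
  refine ⟨fun a => ?_, hI, ?_⟩
  · rw [hopt]
    exact sub_nonneg.2 (hymin _ (hpath a k).1.mem_polytope)
  · exact (integral_mono (hI.sub (integrable_const _)) (hmajI k).1 fun a => (hpath a k).2).trans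
      (hmajI k).2

end Problem

end ASFW

/-! ### Conversion of rates and the final statement. -/

namespace ASFW

theorem pow_le_rpow_half {r β : ℝ} (hr : 0 < r) (hr1 : r < 1) (h : β ≤ 1 - r ^ 2) {k : ℕ}
    (hk : 1 ≤ k) : r ^ k ≤ (1 - β) ^ (((k : ℝ) - 1) / 2) := by
  have hk' : (1 : ℝ) ≤ k := by exact_mod_cast hk
  calc r ^ k ≤ r ^ ((k : ℝ) - 1) := by
        rw [← Real.rpow_natCast]
        exact Real.rpow_le_rpow_of_exponent_ge hr hr1.le (by linarith)
    _ = (r ^ 2) ^ (((k : ℝ) - 1) / 2) := by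
        rw [← Real.rpow_natCast, ← Real.rpow_mul hr.le]
        congr 1
        push_cast
        ring
    _ ≤ (1 - β) ^ (((k : ℝ) - 1) / 2) :=
        Real.rpow_le_rpow (by positivity) (by linarith) (by linarith)

theorem rpow_half_eq {ω : ℝ} (hω : ω < 1) (k : ℕ) :
    (1 - ω) ^ (((k : ℝ) - 1) / 2) = √(1 - ω) ^ k / √(1 - ω) := by
  have h : 0 < 1 - ω := by linarith
  rw [Real.sqrt_eq_rpow, ← Real.rpow_natCast, ← Real.rpow_mul h.le, ← Real.rpow_sub h]
  congr 1
  ring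

end ASFW

theorem corollary2 {n p q : ℕ} (Q : ASFW.Problem n p q) (car : Bool) :
    (∃ β C₂ : ℝ, 0 < β ∧ β < Q.rho car ∧
      (∀ (Ω : Type*) [MeasurableSpace Ω] (P : Measure Ω) [IsProbabilityMeasure P]
          (ξ : (k : ℕ) → Fin (Q.batchSize car k) → Ω → Fin n) (S : ℕ → Ω → ASFW.State p),
          Q.IsASFW car P ξ S → ∀ k : ℕ, 1 ≤ k →
            Integrable (fun a => Q.F (S (k + 1) a).x - Q.optValue) P ∧
            ∫ a, (Q.F (S (k + 1) a).x - Q.optValue) ∂P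
              ≤ C₂ * (1 - β) ^ (((k : ℝ) - 1) / 2)) ∧
      ∃ ω : ℝ, 0 < ω ∧ ω < β ∧
        ∀ (Ω : Type*) [MeasurableSpace Ω] (P : Measure Ω) [IsProbabilityMeasure P]
          (ξ : (k : ℕ) → Fin (Q.batchSize car k) → Ω → Fin n) (S : ℕ → Ω → ASFW.State p),
          Q.IsASFW car P ξ S → ∀ᵐ a ∂P,
            Tendsto (fun k : ℕ => (Q.F (S k a).x - Q.optValue) / (1 - ω) ^ (((k : ℝ) - 1) / 2))
              atTop (𝓝 0) ∧
            ASFW.ConvergesLinearly (fun k => Q.F (S k a).x) Q.optValue) ∧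
    (∀ (Ω : Type*) [MeasurableSpace Ω] (P : Measure Ω) [IsProbabilityMeasure P]
        (Y : ℕ → Ω → ℝ) (l C r : ℝ), 0 < r → r < 1 →
        (∀ k : ℕ, 1 ≤ k → Integrable (Y k) P ∧ ∫ a, |Y k a - l| ∂P ≤ C * r ^ k) →
        ∀ s : ℝ, r < s → s < 1 → ∀ᵐ a ∂P,
          Tendsto (fun k : ℕ => (Y k a - l) / s ^ k) atTop (𝓝 0) ∧
          ASFW.ConvergesLinearly (fun k => Y k a) l) := by
  refine ⟨?_, fun Ω _ P _ Y l C r hr _ h s hs hs1 => ?_⟩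
  · have hρ := Q.rho_pos car
    obtain ⟨r, A, hr0, hr1, hA, hexp⟩ := Q.exists_expected_rate car
    -- The probability spaces of the two claims live in independent universes, so the rate is
    -- obtained once for each; `r` and `t` need not be the same.
    obtain ⟨t, A', ht0, ht1, hA', hexp'⟩ := Q.exists_expected_rate car
    have hr2 : 0 < 1 - r ^ 2 := by nlinarith
    have ht2 : 0 < 1 - t ^ 2 := by nlinarith
    -- The first term gives `β < ρ`, the second `r ≤ √(1 - β)`.
    refine ⟨min (Q.rho car / 2) (1 - r ^ 2), A, by positivity,
      (min_le_left _ _).trans_lt (by linarith), ?_, ?_⟩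
    · intro Ω _ P _ ξ S hS k hk
      obtain ⟨-, hint, hle⟩ := hexp Ω P ξ S hS k
      refine ⟨hint.sub (integrable_const _), hle.trans ?_⟩
      gcongr
      exact ASFW.pow_le_rpow_half hr0 hr1 (min_le_right _ _) hk
    · set β := min (Q.rho car / 2) (1 - r ^ 2)
      have hβ : 0 < β := by positivity
      -- The first term gives `ω < β`, the second `t < √(1 - ω)`, the strict gap of rates that
      -- almost sure convergence requires.
      refine ⟨min (β / 2) ((1 - t ^ 2) / 2), by positivity,
        (min_le_left _ _).trans_lt (by linarith), fun Ω _ P _ ξ S hS => ?_⟩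
      set ω := min (β / 2) ((1 - t ^ 2) / 2) with hω
      have hω0 : 0 < ω := by positivity
      have hωt : ω < 1 - t ^ 2 := (min_le_right _ _).trans_lt (by linarith)
      have hω1 : ω < 1 := by nlinarith
      have hs0 : 0 < √(1 - ω) := Real.sqrt_pos.2 (by linarith)
      have hs1 : √(1 - ω) < 1 := (Real.sqrt_lt' one_pos).2 (by linarith)
      have hts : t < √(1 - ω) := (Real.lt_sqrt ht0.le).2 (by linarith)
      -- The rate `t ^ j` belongs to the iterate with index `j + 1`, hence the division by `t`.
      have hmean : ∀ k : ℕ, 1 ≤ k → Integrable (fun a => Q.F (S k a).x) P ∧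
          ∫ a, |Q.F (S k a).x - Q.optValue| ∂P ≤ A' / t * t ^ k := by
        intro k hk
        obtain ⟨j, rfl⟩ := Nat.exists_eq_add_of_le' hk
        obtain ⟨hnn, hint, hle⟩ := hexp' Ω P ξ S hS j
        refine ⟨hint, ?_⟩
        simp only [abs_of_nonneg (hnn _)]
        rw [pow_succ, mul_comm (t ^ j) t, ← mul_assoc, div_mul_cancel₀ _ ht0.ne']
        exact hle
      filter_upwards [ASFW.ae_tendsto_div_pow P _ ht0 hts hmean] with a ha
      refine ⟨?_, ASFW.convergesLinearly_of_tendsto hs0 hs1 ha⟩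
      have h := ha.const_mul √(1 - ω)
      rw [mul_zero] at h
      refine h.congr fun k => ?_
      rw [ASFW.rpow_half_eq hω1, div_div_eq_mul_div, ← mul_div_assoc, mul_comm]
  · filter_upwards [ASFW.ae_tendsto_div_pow P Y hr hs h] with a ha
    exact ⟨ha, ASFW.convergesLinearly_of_tendsto (hr.trans hs) hs1 ha⟩
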